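/- A \emph{$5/6^*$-triangulation} of the $2$-sphere is a triangulation of the $2$-sphere (as a finite simplicial complex) in which every vertex has degree $5$ or $6$ and no two vertices of degree $5$ are joined by an edge. Its dual cellulation is called a \emph{soccer tiling}: it is a cellulation of the $2$-sphere by pentagons and hexagons in which every vertex has degree $3$ and no two pentagons share a side. A \emph{soccer diagram} is a subcomplex of a soccer tiling that is homeomorphic to a closed disc. Let $D$ be a soccer diagram. If $D$ has at least six $2$-cells, of which at most six are pentagons, then the boundary cycle of $D$ has length (number of edges) $|\partial D| \ge 15$. -/

import Mathlib

namespace Soccer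

/-- The cells of a simplicial complex, or of a subcomplex of its dual, hang together: any two of
them are joined by a chain of cells in which consecutive ones are incident
(and there is at least one cell). -/
def IsConnected {V : Type*} (S : Set (Finset V)) : Prop :=
  (SimpleGraph.fromRel (fun σ τ : S => (σ : Finset V) ⊂ (τ : Finset V))).Connected

/-- The Euler characteristic of a set of simplices of dimension at most two: vertices minus edges
plus triangles. In a dual cellulation vertices become `2`-cells, edges become `1`-cells and
triangles become `0`-cells, so the same number is the Euler characteristic of the
corresponding set of dual cells. -/
noncomputable def eulerChar {V : Type*} (S : Set (Finset V)) : ℤ :=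
  ({σ ∈ S | σ.card = 1}.ncard : ℤ) - ({σ ∈ S | σ.card = 2}.ncard : ℤ)
    + ({σ ∈ S | σ.card = 3}.ncard : ℤ)

section Triangulation

variable {V : Type*} [DecidableEq V]

/-- The vertices adjacent to `v` in `K`, i.e. the vertices of the link of `v`. -/
def neighbors (K : AbstractSimplicialComplex V) (v : V) : Set V :=
  {u | u ≠ v ∧ ({v, u} : Finset V) ∈ K}

/-- The degree of a vertex: the number of edges incident with it. -/
noncomputable def degree (K : AbstractSimplicialComplex V) (v : V) : ℕ :=
  (neighbors K v).ncard

/-- The (`1`-skeleton of the) link of the vertex `v` in `K`. -/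
def linkGraph (K : AbstractSimplicialComplex V) (v : V) : SimpleGraph (neighbors K v) where
  Adj a b := a ≠ b ∧ ({v, (a : V), (b : V)} : Finset V) ∈ K
  symm := ⟨fun a b h => ⟨h.1.symm, by
    have := h.2
    rwa [Finset.pair_comm (a : V) (b : V)] at this⟩⟩
  loopless := ⟨fun _ h => h.1 rfl⟩

/-- `K` is a triangulated closed surface: a finite complex of dimension at most two in which
the link of every vertex is a circle, i.e. a connected graph all of whose vertices have
degree two. -/
structure IsTriangulatedClosedSurface (K : AbstractSimplicialComplex V) : Prop where
  finite_faces : K.faces.Finite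
  card_le : ∀ σ ∈ K, σ.card ≤ 3
  link_connected : ∀ v : V, (linkGraph K v).Connected
  link_regular : ∀ (v : V) (a : neighbors K v), ((linkGraph K v).neighborSet a).ncard = 2

/-- `K` is a triangulated `2`-sphere: a triangulated connected closed surface of Euler
characteristic two (by the classification of surfaces, these are the triangulations of the
`2`-sphere). -/
structure IsTriangulatedSphere (K : AbstractSimplicialComplex V) : Prop
    extends IsTriangulatedClosedSurface K where
  connected : IsConnected K.faces
  eulerChar_eq : eulerChar K.faces = 2

/-- A `5/6*`-triangulation of the `2`-sphere: every vertex has degree `5` or `6`, and no two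
vertices of degree `5` are joined by an edge. -/
structure IsFiveSixStarSphere (K : AbstractSimplicialComplex V) : Prop
    extends IsTriangulatedSphere K where
  degree_eq : ∀ v : V, degree K v = 5 ∨ degree K v = 6
  not_adjacent : ∀ v u : V, degree K v = 5 → u ∈ neighbors K v → degree K u ≠ 5

end Triangulation

/-- A subcomplex of the dual cellulation of a triangulated surface `K`. The dual cell of a
simplex with `j` vertices has dimension `3 - j`, and the dual cell of `τ` lies in the closure of
the dual cell of `σ` exactly when `σ ⊆ τ`. A cell is represented by the simplex that it is
dual to, so a set of cells is a subcomplex when it is closed under passing to larger simplices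
of `K`. -/
structure DualSubcomplex {V : Type*} (K : AbstractSimplicialComplex V) where
  cells : Set (Finset V)
  mem_of_mem : ∀ σ ∈ cells, σ ∈ K
  closed : ∀ σ ∈ cells, ∀ τ ∈ K, σ ⊆ τ → τ ∈ cells

namespace DualSubcomplex

variable {V : Type*} {K : AbstractSimplicialComplex V}

/-- The `2`-cells of the subcomplex, indexed by the vertices of `K` they are dual to. -/
def twoCells (D : DualSubcomplex K) : Set V :=
  {v | ({v} : Finset V) ∈ D.cells}

/-- At a `0`-cell (dual to a triangle `t`), any two `2`-cells of a subcomplex share a `1`-cell of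
that subcomplex, so the link of the `0`-cell in a purely two-dimensional subcomplex is always
an arc or a circle. -/
theorem link_zeroCell [DecidableEq V] (D : DualSubcomplex K) {t : Finset V} (ht : t ∈ K) {a b : V}
    (ha : a ∈ t) (hb : b ∈ t) (haD : a ∈ D.twoCells) : ({a, b} : Finset V) ∈ D.cells := by
  refine D.closed {a} haD _ ((K.isRelLowerSet_faces ht).2 ?_ ⟨a, by simp⟩) (by simp)
  intro x hx
  simp only [Finset.mem_insert, Finset.mem_singleton] at hx
  rcases hx with rfl | rfl <;> assumption

/-- The subcomplex is homeomorphic to a closed disc. A subcomplex in which every cell lies in a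
`2`-cell is a compact surface, with or without boundary (each `1`-cell lies in one or two of its
`2`-cells, and links of `0`-cells are arcs or circles by `link_zeroCell`). By the classification
of surfaces, such a subcomplex of a cellulated sphere is a disc exactly when it is connected and
has Euler characteristic one. -/
structure IsDisc (D : DualSubcomplex K) : Prop where
  pure : ∀ σ ∈ D.cells, ∃ v ∈ σ, v ∈ D.twoCells
  connected : IsConnected D.cells
  eulerChar_eq : eulerChar D.cells = 1

/-- The pentagons of the subcomplex: a `2`-cell has as many sides as the degree of the vertex
it is dual to. -/
def pentagons [DecidableEq V] (D : DualSubcomplex K) : Set V :=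
  {v ∈ D.twoCells | degree K v = 5}

/-- The boundary `1`-cells: those that lie in exactly one `2`-cell of the subcomplex. For a disc
they are the edges of the boundary cycle. -/
def boundaryEdges (D : DualSubcomplex K) : Set (Finset V) :=
  {e ∈ D.cells | e.card = 2 ∧ {v | v ∈ e ∧ v ∈ D.twoCells}.ncard = 1}

/-- The length of the boundary cycle. -/
noncomputable def boundaryLength (D : DualSubcomplex K) : ℕ :=
  D.boundaryEdges.ncard

end DualSubcomplex

/-- A soccer diagram: a subcomplex, homeomorphic to a disc, of a soccer tiling, that is of the
dual cellulation of a `5/6*`-triangulation of the `2`-sphere. -/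
structure IsSoccerDiagram {V : Type*} [DecidableEq V] {K : AbstractSimplicialComplex V}
    (D : DualSubcomplex K) : Prop where
  sphere : IsFiveSixStarSphere K
  disc : D.IsDisc

end Soccer

/-!
The disc is encoded by the set `T` of vertices of the triangulation dual to its `2`-cells. Its
boundary length `b` is the number of edges leaving `T`. All counting is done with sums of indicators
of ordered edges and triangles, for which the fact that every edge lies in two triangles gives the
Gauss–Bonnet formula `FiveSixSphere.sixChi_eq`: for a disc with `p` pentagons, `b = 2 c + 6 - p`,
where `c` is the number of boundary corners at which two cells of the disc meet.

The little topology that is needed is derived from one estimate, `FiveSixSphere.Conn.sixChi_le`: a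
connected proper subcomplex of the triangulation has Euler characteristic at most one. Together with
the duality `FiveSixSphere.sixChi_add_compl` it shows that removing a boundary cell from a disc
leaves a disc if the result is connected, that a boundary cell whose removal disconnects a disc
splits it into two discs sharing that cell, and that discs have connected complement.

The inequality is proved by induction on the number of cells (`FiveSixSphere.Disc.bounds`), together
with bounds for discs with at most five cells. A disc with a cut cell is handled by adding the bounds
for the two parts. In a disc without cut cells, every boundary cell meets the boundary in one arc,
so `c` is the number of boundary cells; small discs are then immediate, as at most half of the
boundary cells are pentagons. In a larger one, a cell with at least half of its sides on the boundary
can be removed without lengthening the boundary. If there is none, Gauss–Bonnet forces `p = 6` and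
exactly two boundary sides for each boundary cell. If `b < 15`, there are at most seven boundary
cells, `q ≤ 3` of them pentagons. Removing this ring of cells leaves a union of discs with `6 - q`
pentagons and total boundary length at most `14 - q`, which contradicts the inductive bounds
(`FiveSixSphere.NoCut.fifteen_le`).
-/

namespace Soccer

set_option linter.unusedSectionVars false

open Finset

open scoped Classical in
/-- The combinatorial content of a `5/6*`-triangulation of the `2`-sphere, as relations on its
vertices: `Adj x y` says that `xy` is an edge and `Tri x y z` that `xyz` is a triangle. Connectivity
of the vertex links (`link_cut`) and of the complex (`cut`) is phrased through edges that leave a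
set of vertices. In `euler` edges and triangles are counted as ordered pairs and triples, two and
six times each, so that six times the Euler characteristic appears. -/
structure FiveSixSphere (V : Type*) [Fintype V] where
  Adj : V → V → Prop
  Tri : V → V → V → Prop
  adj_symm : ∀ {x y}, Adj x y → Adj y x
  adj_irrefl : ∀ x, ¬ Adj x x
  tri_swap : ∀ {x y z}, Tri x y z → Tri y x z
  tri_swap' : ∀ {x y z}, Tri x y z → Tri x z y
  adj_of_tri : ∀ {x y z}, Tri x y z → Adj x y
  card_tri : ∀ {x y}, Adj x y → #{z | Tri x y z} = 2
  link_cut : ∀ (v : V) (P : Finset V), (∃ x ∈ P, Adj v x) → (∃ y ∉ P, Adj v y) →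
    ∃ x ∈ P, ∃ y ∉ P, Tri v x y
  cut : ∀ P : Finset V, P.Nonempty → P ≠ univ → ∃ x ∈ P, ∃ y ∉ P, Adj x y
  euler : 6 * (Fintype.card V : ℤ) - 3 * ∑ x, ∑ y, (if Adj x y then 1 else 0)
    + ∑ x, ∑ y, ∑ z, (if Tri x y z then 1 else 0) = 12
  degree_eq : ∀ x, #{y | Adj x y} = 5 ∨ #{y | Adj x y} = 6
  not_adj : ∀ {x y}, Adj x y → #{z | Adj x z} = 5 → #{z | Adj y z} ≠ 5

namespace FiveSixSphere

variable {V : Type*} [Fintype V] [DecidableEq V] (S : FiveSixSphere V)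

/-! ### Counting functions -/

open scoped Classical in
/-- Indicator of the edges. -/
noncomputable def adjInd (x y : V) : ℤ := if S.Adj x y then 1 else 0

open scoped Classical in
/-- Indicator of the triangles. -/
noncomputable def triInd (x y z : V) : ℤ := if S.Tri x y z then 1 else 0

/-- The number of neighbours of `v` in `P`. -/
noncomputable def nbrs (v : V) (P : Finset V) : ℤ := ∑ x ∈ P, S.adjInd v x

/-- The number of oriented edges of the link of `v` that lead from `P` to `Q`; an edge of the link
inside `P` is counted twice in `linkArcs v P P`. -/
noncomputable def linkArcs (v : V) (P Q : Finset V) : ℤ := ∑ x ∈ P, ∑ y ∈ Q, S.triInd v x y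

/-- The number of oriented edges from `P` to `Q`. -/
noncomputable def arcs (P Q : Finset V) : ℤ := ∑ v ∈ P, S.nbrs v Q

/-- The number of ordered triangles with vertices in `P`, `Q`, `R` in this order. -/
noncomputable def tris (P Q R : Finset V) : ℤ := ∑ v ∈ P, S.linkArcs v Q R

/-- Six times the Euler characteristic of the subcomplex induced on `T`. The factor six comes from
counting ordered edges and triangles. -/
noncomputable def sixChi (T : Finset V) : ℤ := 6 * (#T : ℤ) - 3 * S.arcs T T + S.tris T T T

/-- The number of edges that leave `T`: the length of the boundary of the union of the dual cells
of the vertices in `T`. -/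
noncomputable def perim (T : Finset V) : ℤ := S.arcs T Tᶜ

/-- Six minus the degree: one at a pentagon and zero at a hexagon. -/
noncomputable def defect (x : V) : ℤ := 6 - S.nbrs x univ

/-- The number of pentagons in `T`, as a sum of defects. -/
noncomputable def pent (T : Finset V) : ℤ := ∑ x ∈ T, S.defect x

open scoped Classical in
/-- The vertices of `T` with a neighbour outside `T`, i.e. the `2`-cells with a boundary side. -/
noncomputable def rim (T : Finset V) : Finset V := {x ∈ T | ∃ y ∉ T, S.Adj x y}

/-- `T` is nonempty and spans a connected graph: every nonempty proper subset of `T` is left by an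
edge that stays in `T`. -/
def Conn (T : Finset V) : Prop :=
  T.Nonempty ∧ ∀ P ⊆ T, P.Nonempty → P ≠ T → ∃ x ∈ P, ∃ y ∈ T, y ∉ P ∧ S.Adj x y

variable {S}

/-! ### Elementary properties of the counting functions -/

lemma mem_rim {T : Finset V} {x : V} : x ∈ S.rim T ↔ x ∈ T ∧ ∃ y ∉ T, S.Adj x y := by
  simp [rim]

lemma rim_subset (T : Finset V) : S.rim T ⊆ T := fun _ h => (mem_rim.1 h).1

lemma adjInd_of_adj {x y : V} (h : S.Adj x y) : S.adjInd x y = 1 := if_pos h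
lemma adjInd_of_not_adj {x y : V} (h : ¬ S.Adj x y) : S.adjInd x y = 0 := if_neg h
lemma triInd_of_tri {x y z : V} (h : S.Tri x y z) : S.triInd x y z = 1 := if_pos h
lemma triInd_of_not_tri {x y z : V} (h : ¬ S.Tri x y z) : S.triInd x y z = 0 := if_neg h

lemma adjInd_nonneg (x y : V) : 0 ≤ S.adjInd x y := by unfold adjInd; split_ifs <;> simp
lemma triInd_nonneg (x y z : V) : 0 ≤ S.triInd x y z := by unfold triInd; split_ifs <;> simp

lemma adjInd_comm (x y : V) : S.adjInd x y = S.adjInd y x := by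
  unfold adjInd; congr 1; exact propext ⟨S.adj_symm, S.adj_symm⟩

lemma triInd_swap (x y z : V) : S.triInd x y z = S.triInd y x z := by
  unfold triInd; congr 1; exact propext ⟨S.tri_swap, S.tri_swap⟩

lemma triInd_swap' (x y z : V) : S.triInd x y z = S.triInd x z y := by
  unfold triInd; congr 1; exact propext ⟨S.tri_swap', S.tri_swap'⟩

@[simp] lemma adjInd_self (x : V) : S.adjInd x x = 0 := adjInd_of_not_adj (S.adj_irrefl x)

@[simp] lemma triInd_self_left (x y : V) : S.triInd x x y = 0 :=
  triInd_of_not_tri fun h => S.adj_irrefl x (S.adj_of_tri h)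

@[simp] lemma triInd_self_right (x y : V) : S.triInd x y y = 0 := by
  rw [triInd_swap, triInd_swap', triInd_self_left]

@[simp] lemma triInd_self_outer (x y : V) : S.triInd x y x = 0 := by
  rw [triInd_swap', triInd_self_left]

lemma adj_of_tri' {x y z : V} (h : S.Tri x y z) : S.Adj x z := S.adj_of_tri (S.tri_swap' h)
lemma adj_of_tri'' {x y z : V} (h : S.Tri x y z) : S.Adj y z := adj_of_tri' (S.tri_swap h)

lemma nbrs_univ (v : V) : S.nbrs v univ = 5 ∨ S.nbrs v univ = 6 := by
  classical
  have h := S.degree_eq v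
  simp only [nbrs, adjInd, sum_boole]
  rcases h with h | h
  · left; exact_mod_cast (by convert h)
  · right; exact_mod_cast (by convert h)

lemma defect_eq (v : V) : S.defect v = 0 ∨ S.defect v = 1 := by
  unfold defect; rcases nbrs_univ (S := S) v with h | h <;> rw [h] <;> simp

lemma defect_add_le {x y : V} (h : S.Adj x y) : S.defect x + S.defect y ≤ 1 := by
  classical
  have h1 := S.not_adj h
  have hx : ∀ v, S.nbrs v univ = (#{z | S.Adj v z} : ℤ) := fun v => by
    simp [nbrs, adjInd, sum_boole]
  have := S.degree_eq x
  have := S.degree_eq y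
  simp only [defect, hx]
  by_contra hc
  have : #{z | S.Adj x z} = 5 ∧ #{z | S.Adj y z} = 5 := by omega
  exact h1 (by convert this.1) (by convert this.2)

lemma sum_triInd (x y : V) : ∑ z, S.triInd x y z = 2 * S.adjInd x y := by
  classical
  by_cases h : S.Adj x y
  · rw [adjInd_of_adj h]
    have := S.card_tri h
    simp only [triInd, sum_boole]
    have h2 : #{z | S.Tri x y z} = 2 := by convert this
    rw [h2]; rfl
  · rw [adjInd_of_not_adj h]
    simp only [mul_zero]
    exact sum_eq_zero fun z _ => triInd_of_not_tri fun ht => h (S.adj_of_tri ht)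

lemma nbrs_add_compl (v : V) (T : Finset V) : S.nbrs v T + S.nbrs v Tᶜ = S.nbrs v univ :=
  sum_add_sum_compl T _

lemma linkArcs_add_compl (v : V) (P T : Finset V) :
    S.linkArcs v P T + S.linkArcs v P Tᶜ = 2 * S.nbrs v P := by
  simp only [linkArcs, nbrs, ← sum_add_distrib, mul_sum]
  refine sum_congr rfl fun x _ => ?_
  rw [sum_add_sum_compl, sum_triInd]

lemma linkArcs_comm (v : V) (P Q : Finset V) : S.linkArcs v P Q = S.linkArcs v Q P := by
  unfold linkArcs
  rw [sum_comm]
  exact sum_congr rfl fun x _ => sum_congr rfl fun y _ => triInd_swap' _ _ _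

lemma arcs_comm (P Q : Finset V) : S.arcs P Q = S.arcs Q P := by
  unfold arcs nbrs
  rw [sum_comm]
  exact sum_congr rfl fun x _ => sum_congr rfl fun y _ => adjInd_comm _ _

lemma tris_comm (P Q R : Finset V) : S.tris P Q R = S.tris Q P R := by
  unfold tris linkArcs
  rw [sum_comm]
  exact sum_congr rfl fun x _ => sum_congr rfl fun y _ => sum_congr rfl fun z _ => triInd_swap _ _ _

lemma tris_comm' (P Q R : Finset V) : S.tris P Q R = S.tris P R Q :=
  sum_congr rfl fun _ _ => linkArcs_comm _ _ _

lemma tris_add_compl (P Q T : Finset V) :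
    S.tris P Q T + S.tris P Q Tᶜ = 2 * S.arcs P Q := by
  simp only [tris, arcs, ← sum_add_distrib, mul_sum, linkArcs_add_compl]

/-! ### The Gauss–Bonnet formula and duality -/

lemma arcs_add_perim (T : Finset V) : S.arcs T T + S.perim T = 6 * (#T : ℤ) - S.pent T := by
  simp only [arcs, perim, pent, defect, ← sum_add_distrib, nbrs_add_compl, sum_sub_distrib,
    sum_const]
  simp; ring

/-- Gauss–Bonnet: the Euler characteristic is determined by the number of pentagons, the length of
the boundary and the number of boundary corners at which two cells of `T` meet (counted twice by
`tris T T Tᶜ`). -/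
lemma sixChi_eq (T : Finset V) : S.sixChi T = S.pent T + S.perim T - S.tris T T Tᶜ := by
  have h1 := arcs_add_perim (S := S) T
  have h2 := tris_add_compl (S := S) T T T
  unfold sixChi
  linarith

lemma perim_compl (T : Finset V) : S.perim Tᶜ = S.perim T := by
  simp only [perim, compl_compl]; exact arcs_comm _ _

lemma pent_add_compl (T : Finset V) : S.pent T + S.pent Tᶜ = S.pent univ := sum_add_sum_compl _ _

lemma sixChi_univ : S.sixChi univ = 12 := by
  rw [← S.euler]; rfl

/-- Alexander duality at the level of Euler characteristics: those of a set of vertices and of its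
complement add up to two. -/
lemma sixChi_add_compl (T : Finset V) : S.sixChi T + S.sixChi Tᶜ = 12 := by
  have h1 := sixChi_eq (S := S) T
  have h2 := sixChi_eq (S := S) Tᶜ
  have h3 := sixChi_eq (S := S) univ
  have h4 : S.tris T Tᶜ T + S.tris T Tᶜ Tᶜ = 2 * S.perim T := tris_add_compl _ _ _
  rw [perim_compl, compl_compl] at h2
  rw [sixChi_univ] at h3
  simp only [perim, compl_univ, arcs, nbrs, tris, linkArcs, sum_empty, sum_const_zero] at h3
  have h5 := tris_comm' (S := S) T Tᶜ T
  have h6 : S.tris T Tᶜ Tᶜ = S.tris Tᶜ Tᶜ T := by rw [tris_comm, tris_comm']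
  have h7 := pent_add_compl (S := S) T
  linarith

/-! ### Vertex links and removal of a vertex -/

lemma even_linkArcs_self (v : V) (P : Finset V) : Even (S.linkArcs v P P) := by
  induction P using Finset.induction_on with
  | empty => simp [linkArcs]
  | insert a P ha ih =>
    have : S.linkArcs v (insert a P) (insert a P) =
        2 * (∑ y ∈ P, S.triInd v a y) + S.linkArcs v P P := by
      simp only [linkArcs, sum_insert ha, triInd_self_right, sum_add_distrib]
      have : ∑ x ∈ P, S.triInd v x a = ∑ y ∈ P, S.triInd v a y :=
        sum_congr rfl fun x _ => triInd_swap' _ _ _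
      rw [this]; ring
    rw [this]
    exact (even_two_mul _).add ih

lemma linkArcs_pos {v x y : V} {P Q : Finset V} (hx : x ∈ P) (hy : y ∈ Q) (h : S.Tri v x y) :
    0 < S.linkArcs v P Q :=
  sum_pos' (fun _ _ => sum_nonneg fun _ _ => triInd_nonneg _ _ _)
    ⟨x, hx, sum_pos' (fun _ _ => triInd_nonneg _ _ _) ⟨y, hy, by rw [triInd_of_tri h]; simp⟩⟩

/-- A nonempty proper part `P` of the circle that is the link of `v` spans at most `n - 1` edges, `n`
being its number of vertices: at least one edge of the circle leaves `P`, hence two do by parity. -/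
lemma linkArcs_self_le {v : V} {P : Finset V} (h1 : ∃ x ∈ P, S.Adj v x) (h2 : ∃ y ∉ P, S.Adj v y) :
    S.linkArcs v P P + 2 ≤ 2 * S.nbrs v P := by
  obtain ⟨x, hx, y, hy, h⟩ := S.link_cut v P h1 h2
  have h3 := linkArcs_add_compl (S := S) v P P
  have h4 := linkArcs_pos hx (mem_compl.2 hy) h
  obtain ⟨k, hk⟩ := even_linkArcs_self (S := S) v P
  omega

lemma arcs_insert {v : V} {U : Finset V} (hv : v ∉ U) :
    S.arcs (insert v U) (insert v U) = S.arcs U U + 2 * S.nbrs v U := by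
  simp only [arcs, nbrs, sum_insert hv, adjInd_self, sum_add_distrib]
  have : ∑ x ∈ U, S.adjInd x v = ∑ y ∈ U, S.adjInd v y :=
    sum_congr rfl fun x _ => adjInd_comm _ _
  rw [this]; ring

lemma tris_insert {v : V} {U : Finset V} (hv : v ∉ U) :
    S.tris (insert v U) (insert v U) (insert v U) = S.tris U U U + 3 * S.linkArcs v U U := by
  simp only [tris, linkArcs, sum_insert hv, triInd_self_left, triInd_self_right, triInd_self_outer,
    sum_add_distrib, sum_const_zero]
  have h1 : ∑ x ∈ U, ∑ y ∈ U, S.triInd x v y = ∑ x ∈ U, ∑ y ∈ U, S.triInd v x y :=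
    sum_congr rfl fun x _ => sum_congr rfl fun y _ => triInd_swap _ _ _
  have h2 : ∑ x ∈ U, ∑ y ∈ U, S.triInd x y v = ∑ x ∈ U, ∑ y ∈ U, S.triInd v x y :=
    sum_congr rfl fun x _ => sum_congr rfl fun y _ => by rw [triInd_swap', triInd_swap]
  rw [h1, h2]; ring

lemma nbrs_insert_self {v : V} {U : Finset V} (hv : v ∉ U) :
    S.nbrs v (insert v U) = S.nbrs v U := by
  simp [nbrs, sum_insert hv]

lemma linkArcs_insert_self {v : V} {U : Finset V} (hv : v ∉ U) :
    S.linkArcs v (insert v U) (insert v U) = S.linkArcs v U U := by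
  simp [linkArcs, sum_insert hv]

lemma sixChi_erase {v : V} {T : Finset V} (hv : v ∈ T) :
    S.sixChi T = S.sixChi (T.erase v) + 6 - 6 * S.nbrs v T + 3 * S.linkArcs v T T := by
  have h := notMem_erase v T
  generalize hU : T.erase v = U at h
  obtain rfl : T = insert v U := by rw [← hU, insert_erase hv]
  rw [sixChi, sixChi, arcs_insert h, tris_insert h, nbrs_insert_self h, linkArcs_insert_self h,
    card_insert_of_notMem h]
  push_cast; ring

lemma pent_erase {v : V} {T : Finset V} (hv : v ∈ T) :
    S.pent T = S.pent (T.erase v) + S.defect v := (sum_erase_add _ _ hv).symm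

lemma perim_erase {v : V} {T : Finset V} (hv : v ∈ T) :
    S.perim T = S.perim (T.erase v) + S.nbrs v Tᶜ - S.nbrs v T := by
  have h1 := arcs_add_perim (S := S) T
  have h2 := arcs_add_perim (S := S) (T.erase v)
  have h3 := pent_erase (S := S) hv
  have h4 := nbrs_add_compl (S := S) v T
  have h5 : (#(T.erase v) : ℤ) = #T - 1 := by
    rw [card_erase_of_mem hv, Nat.cast_sub (card_pos.2 ⟨v, hv⟩)]; simp
  have h6 : S.arcs T T = S.arcs (T.erase v) (T.erase v) + 2 * S.nbrs v T := by
    have h := notMem_erase v T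
    generalize hU : T.erase v = U at h
    obtain rfl : T = insert v U := by rw [← hU, insert_erase hv]
    rw [arcs_insert h, nbrs_insert_self h]
  unfold defect at h3
  linarith

/-! ### Sets of vertices without edges between them -/

/-- `P` and `R` are disjoint and no edge joins them. -/
def Apart (S : FiveSixSphere V) (P R : Finset V) : Prop :=
  Disjoint P R ∧ ∀ x ∈ P, ∀ y ∈ R, ¬ S.Adj x y

lemma Apart.symm {P R : Finset V} (h : S.Apart P R) : S.Apart R P :=
  ⟨h.1.symm, fun x hx y hy ha => h.2 y hy x hx (S.adj_symm ha)⟩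

lemma nbrs_union {P R : Finset V} (h : Disjoint P R) (v : V) :
    S.nbrs v (P ∪ R) = S.nbrs v P + S.nbrs v R := sum_union h

lemma Apart.nbrs_eq_zero {P R : Finset V} (h : S.Apart P R) {x : V} (hx : x ∈ P) :
    S.nbrs x R = 0 := sum_eq_zero fun y hy => adjInd_of_not_adj (h.2 x hx y hy)

lemma Apart.arcs_union {P R : Finset V} (h : S.Apart P R) :
    S.arcs (P ∪ R) (P ∪ R) = S.arcs P P + S.arcs R R := by
  simp only [arcs, sum_union h.1, nbrs_union h.1]
  congr 1
  · exact sum_congr rfl fun x hx => by rw [h.nbrs_eq_zero hx, add_zero]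
  · exact sum_congr rfl fun x hx => by rw [h.symm.nbrs_eq_zero hx, zero_add]

lemma Apart.linkArcs_union {P R : Finset V} (h : S.Apart P R) (v : V) :
    S.linkArcs v (P ∪ R) (P ∪ R) = S.linkArcs v P P + S.linkArcs v R R := by
  simp only [linkArcs, sum_union h.1]
  congr 1
  · refine sum_congr rfl fun x hx => ?_
    rw [add_eq_left]
    exact sum_eq_zero fun y hy => triInd_of_not_tri fun ht => h.2 x hx y hy (adj_of_tri'' ht)
  · refine sum_congr rfl fun x hx => ?_
    rw [add_eq_right]
    exact sum_eq_zero fun y hy => triInd_of_not_tri fun ht => h.symm.2 x hx y hy (adj_of_tri'' ht)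

lemma Apart.linkArcs_eq_zero {P R : Finset V} (h : S.Apart P R) {x : V} (hx : x ∈ P) :
    S.linkArcs x R R = 0 :=
  sum_eq_zero fun y hy => sum_eq_zero fun _ _ =>
    triInd_of_not_tri fun ht => h.2 x hx y hy (S.adj_of_tri ht)

lemma Apart.tris_union {P R : Finset V} (h : S.Apart P R) :
    S.tris (P ∪ R) (P ∪ R) (P ∪ R) = S.tris P P P + S.tris R R R := by
  simp only [tris, sum_union h.1, h.linkArcs_union]
  congr 1
  · exact sum_congr rfl fun x hx => by rw [h.linkArcs_eq_zero hx, add_zero]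
  · exact sum_congr rfl fun x hx => by rw [h.symm.linkArcs_eq_zero hx, zero_add]

lemma Apart.sixChi_union {P R : Finset V} (h : S.Apart P R) :
    S.sixChi (P ∪ R) = S.sixChi P + S.sixChi R := by
  rw [sixChi, h.arcs_union, h.tris_union, card_union_of_disjoint h.1, sixChi, sixChi]
  push_cast; ring

lemma pent_union {P R : Finset V} (h : Disjoint P R) :
    S.pent (P ∪ R) = S.pent P + S.pent R := sum_union h

lemma Apart.perim_union {P R : Finset V} (h : S.Apart P R) :
    S.perim (P ∪ R) = S.perim P + S.perim R := by
  have h1 := arcs_add_perim (S := S) (P ∪ R)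
  have h2 := arcs_add_perim (S := S) P
  have h3 := arcs_add_perim (S := S) R
  rw [h.arcs_union, card_union_of_disjoint h.1, pent_union h.1] at h1
  push_cast at h1
  linarith

lemma sixChi_insert {v : V} {U : Finset V} (hv : v ∉ U) :
    S.sixChi (insert v U) = S.sixChi U + 6 - 6 * S.nbrs v U + 3 * S.linkArcs v U U := by
  rw [sixChi_erase (mem_insert_self v U), erase_insert hv, nbrs_insert_self hv,
    linkArcs_insert_self hv]

lemma Apart.sixChi_insert_union {P R : Finset V} (h : S.Apart P R) {v : V} (hP : v ∉ P)
    (hR : v ∉ R) :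
    S.sixChi (insert v (P ∪ R)) + 6 = S.sixChi (insert v P) + S.sixChi (insert v R) := by
  rw [sixChi_insert hP, sixChi_insert hR, sixChi_insert (by simp [hP, hR]), h.sixChi_union,
    nbrs_union h.1, h.linkArcs_union]
  ring

lemma Apart.perim_insert_union {P R : Finset V} (h : S.Apart P R) {v : V} (hP : v ∉ P)
    (hR : v ∉ R) :
    S.perim (insert v (P ∪ R)) + S.nbrs v univ = S.perim (insert v P) + S.perim (insert v R) := by
  have hU : v ∉ P ∪ R := by simp [hP, hR]
  have h1 := arcs_add_perim (S := S) (insert v (P ∪ R))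
  have h2 := arcs_add_perim (S := S) (insert v P)
  have h3 := arcs_add_perim (S := S) (insert v R)
  rw [arcs_insert hU, card_insert_of_notMem hU, pent, sum_insert hU, ← pent,
    h.arcs_union, card_union_of_disjoint h.1, pent_union h.1, nbrs_union h.1] at h1
  rw [arcs_insert hP, card_insert_of_notMem hP, pent, sum_insert hP, ← pent] at h2
  rw [arcs_insert hR, card_insert_of_notMem hR, pent, sum_insert hR, ← pent] at h3
  have h4 : S.defect v = 6 - S.nbrs v univ := rfl
  push_cast at h1 h2 h3
  linarith

/-! ### Connectivity, cut vertices and the Euler characteristic -/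

/-- Connectivity need only be tested on subsets that avoid a given vertex `v`. -/
lemma conn_of_pointed {A : Finset V} {v : V} (hv : v ∈ A)
    (h : ∀ Q ⊆ A, v ∉ Q → Q.Nonempty → ∃ x ∈ Q, ∃ y ∈ A, y ∉ Q ∧ S.Adj x y) : S.Conn A := by
  refine ⟨⟨v, hv⟩, fun Q hQ hne hQA => ?_⟩
  by_cases hvQ : v ∈ Q
  · obtain ⟨x, hx, y, hy, hyx, ha⟩ := h (A \ Q) sdiff_subset (by simp [hvQ])
      (sdiff_nonempty.2 fun hs => hQA (hQ.antisymm hs))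
    rw [mem_sdiff] at hx hyx
    refine ⟨y, ?_, x, hx.1, hx.2, S.adj_symm ha⟩
    by_contra hc
    exact hyx ⟨hy, hc⟩
  · exact h Q hQ hvQ hne

lemma Apart.conn_insert {P R : Finset V} (h : S.Apart P R) {v : V} (hP : v ∉ P)
    (hT : S.Conn (insert v (P ∪ R))) : S.Conn (insert v P) := by
  refine conn_of_pointed (mem_insert_self v P) fun Q hQ hvQ hne => ?_
  have hQP : Q ⊆ P := fun x hx => (mem_insert.1 (hQ hx)).resolve_left (by rintro rfl; exact hvQ hx)
  obtain ⟨x, hx, y, hy, hyQ, ha⟩ := hT.2 Q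
    (hQP.trans (subset_union_left.trans (subset_insert _ _))) hne
    (by rintro rfl; exact hvQ (mem_insert_self _ _))
  refine ⟨x, hx, y, ?_, hyQ, ha⟩
  rw [mem_insert, mem_union] at hy
  rcases hy with rfl | hy | hy
  · exact mem_insert_self _ _
  · exact mem_insert_of_mem hy
  · exact absurd ha (h.2 x (hQP hx) y hy)

lemma exists_apart {U : Finset V} (hU : U.Nonempty) (h : ¬ S.Conn U) :
    ∃ P R : Finset V, P.Nonempty ∧ R.Nonempty ∧ S.Apart P R ∧ U = P ∪ R := by
  simp only [Conn, hU, true_and, not_forall] at h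
  obtain ⟨P, hP, hne, hPU, h⟩ := h
  refine ⟨P, U \ P, hne, sdiff_nonempty.2 fun hs => hPU (hP.antisymm hs), ⟨disjoint_sdiff, ?_⟩,
    (union_sdiff_of_subset hP).symm⟩
  intro x hx y hy ha
  rw [mem_sdiff] at hy
  exact h ⟨x, hx, y, hy.1, hy.2, ha⟩

/-- If removing `v` disconnects `T`, then `T` is the union of two smaller connected sets that meet
only in `v`. -/
lemma Conn.exists_split {T : Finset V} (hT : S.Conn T) {v : V} (hv : v ∈ T)
    (hne : (T.erase v).Nonempty) (h : ¬ S.Conn (T.erase v)) :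
    ∃ P R : Finset V, P.Nonempty ∧ R.Nonempty ∧ v ∉ P ∧ v ∉ R ∧ S.Apart P R ∧
      T = insert v (P ∪ R) ∧ S.Conn (insert v P) ∧ S.Conn (insert v R) := by
  obtain ⟨P, R, hP, hR, hPR, hU⟩ := exists_apart hne h
  have hTe : T = insert v (P ∪ R) := by rw [← hU, insert_erase hv]
  have hvU : v ∉ P ∪ R := hU ▸ notMem_erase v T
  rw [mem_union, not_or] at hvU
  refine ⟨P, R, hP, hR, hvU.1, hvU.2, hPR, hTe, hPR.conn_insert hvU.1 (hTe ▸ hT),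
    hPR.symm.conn_insert hvU.2 ?_⟩
  rw [union_comm, ← hTe]; exact hT

lemma rim_nonempty {T : Finset V} (hT : T.Nonempty) (hT' : T ≠ univ) : (S.rim T).Nonempty := by
  obtain ⟨x, hx, y, hy, h⟩ := S.cut T hT hT'
  exact ⟨x, mem_rim.2 ⟨hx, y, hy, h⟩⟩

lemma Conn.exists_adj {T : Finset V} (hT : S.Conn T) {v : V} (hv : v ∈ T)
    (hne : (T.erase v).Nonempty) : ∃ x ∈ T, S.Adj v x := by
  obtain ⟨x, hx, y, hy, -, h⟩ := hT.2 {v} (by simpa using hv) (by simp) (by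
    rintro h; rw [← h] at hne; simp at hne)
  rw [mem_singleton] at hx
  exact ⟨y, hy, hx ▸ h⟩

lemma sixChi_singleton (v : V) : S.sixChi {v} = 6 := by
  simp [sixChi, arcs, nbrs, tris, linkArcs]

lemma Conn.linkArcs_le {T : Finset V} (hT : S.Conn T) {v : V} (hv : v ∈ S.rim T)
    (hne : (T.erase v).Nonempty) : S.linkArcs v T T + 2 ≤ 2 * S.nbrs v T :=
  linkArcs_self_le (hT.exists_adj (mem_rim.1 hv).1 hne) (mem_rim.1 hv).2

/-- A connected proper subcomplex has Euler characteristic at most one. By induction: removing a rim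
vertex `v` does not decrease the Euler characteristic, because the part of the circle around `v`
that lies in `T` is a nonempty union of arcs; and if `v` is a cut vertex, the set is the
one-point union of two smaller ones. -/
lemma Conn.sixChi_le {T : Finset V} (hT : S.Conn T) (hT' : T ≠ univ) : S.sixChi T ≤ 6 := by
  induction hn : #T using Nat.strong_induction_on generalizing T with
  | _ n ih =>
  obtain ⟨v, hv⟩ := rim_nonempty (S := S) hT.1 hT'
  have hvT := rim_subset _ hv
  rcases (T.erase v).eq_empty_or_nonempty with he | hne
  · rw [erase_eq_empty_iff] at he
    rcases he with rfl | rfl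
    · simp at hvT
    · rw [sixChi_singleton]
  by_cases hc : S.Conn (T.erase v)
  · have h1 := ih _ (hn ▸ card_erase_lt_of_mem hvT) hc
      (fun h => notMem_erase v T (h ▸ mem_univ v)) rfl
    have h2 := hT.linkArcs_le hv hne
    have h3 := sixChi_erase (S := S) hvT
    linarith
  · obtain ⟨P, R, hP, hR, hvP, hvR, hPR, rfl, cP, cR⟩ := hT.exists_split hvT hne hc
    have hcard := card_insert_of_notMem (s := P ∪ R) (a := v) (by simp [hvP, hvR])
    rw [card_union_of_disjoint hPR.1] at hcard
    have h1 := ih _ (by rw [← hn, hcard, card_insert_of_notMem hvP]; have := hR.card_pos; omega) cP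
      (fun h => by
        obtain ⟨y, hy⟩ := hR
        have := mem_univ y
        rw [← h, mem_insert] at this
        rcases this with rfl | h
        · exact hvR hy
        · exact disjoint_left.1 hPR.1 h hy) rfl
    have h2 := ih _ (by rw [← hn, hcard, card_insert_of_notMem hvR]; have := hP.card_pos; omega) cR
      (fun h => by
        obtain ⟨y, hy⟩ := hP
        have := mem_univ y
        rw [← h, mem_insert] at this
        rcases this with rfl | h
        · exact hvP hy
        · exact disjoint_left.1 hPR.1 hy h) rfl
    have := hPR.sixChi_insert_union hvP hvR
    linarith

/-- If the complement of `Q ∪ R` is connected and no edge joins `Q` and `R`, the complement of `Q` is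
connected: every part of `R` is attached to the rest, since the whole complex is connected. -/
lemma Conn.compl_of_apart {Q R : Finset V} (hT : S.Conn (Q ∪ R)ᶜ) (h : S.Apart Q R) :
    S.Conn Qᶜ := by
  obtain ⟨v, hv⟩ := hT.1
  have hsub : (Q ∪ R)ᶜ ⊆ Qᶜ := compl_subset_compl.2 subset_union_left
  have key : ∀ P ⊆ Qᶜ, P.Nonempty → Disjoint P (Q ∪ R)ᶜ →
      ∃ x ∈ P, ∃ y ∈ Qᶜ, y ∉ P ∧ S.Adj x y := by
    intro P hP hne hd
    obtain ⟨x, hx, y, hy, ha⟩ := S.cut P hne (by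
      rintro rfl; exact disjoint_left.1 hd (mem_univ v) hv)
    refine ⟨x, hx, y, ?_, hy, ha⟩
    rw [mem_compl]
    intro hyQ
    have hxR : x ∈ R := by
      by_contra hxR
      have := mem_compl.1 (hP hx)
      exact disjoint_left.1 hd hx (by simp [this, hxR])
    exact h.2 y hyQ x hxR (S.adj_symm ha)
  refine conn_of_pointed (hsub hv) fun P hP hvP hne => ?_
  by_cases hd : Disjoint P (Q ∪ R)ᶜ
  · exact key P hP hne hd
  · obtain ⟨x, hx, y, hy, hyP, ha⟩ := hT.2 (P ∩ (Q ∪ R)ᶜ) inter_subset_right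
      (not_disjoint_iff_nonempty_inter.1 hd)
      (fun he => hvP (mem_of_mem_inter_left (he.symm ▸ hv)))
    refine ⟨x, mem_of_mem_inter_left hx, y, hsub hy, fun hyP' => hyP (mem_inter.2 ⟨hyP', hy⟩), ha⟩

/-! ### Discs -/

/-- `T` is connected and has Euler characteristic one. The dual cells of the vertices in `T` then
form a disc. -/
def Disc (S : FiveSixSphere V) (T : Finset V) : Prop := S.Conn T ∧ S.sixChi T = 6

lemma Disc.ne_univ {T : Finset V} (hT : S.Disc T) : T ≠ univ := by
  rintro rfl
  have := hT.2
  rw [sixChi_univ] at this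
  norm_num at this

/-- A disc does not separate the sphere. If its complement were `Q ∪ R` with no edges between the
two parts, then the complements of `Q` and `R` are connected, so `Q` and `R` would have Euler
characteristic at least one each, whereas that of the complement of a disc is one. -/
lemma Disc.compl_conn {T : Finset V} (hT : S.Disc T) : S.Conn Tᶜ := by
  by_contra hc
  have hne : Tᶜ.Nonempty := by
    rw [nonempty_iff_ne_empty, Ne, compl_eq_empty_iff]; exact hT.ne_univ
  obtain ⟨Q, R, hQ, hR, hQR, hU⟩ := exists_apart hne hc
  have hT' : T = (Q ∪ R)ᶜ := by rw [← hU, compl_compl]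
  have h1 := (Conn.compl_of_apart (hT' ▸ hT.1) hQR).sixChi_le (by
    rw [Ne, compl_eq_univ_iff]; exact hQ.ne_empty)
  have h2 := (Conn.compl_of_apart (by rw [union_comm]; exact hT' ▸ hT.1) hQR.symm).sixChi_le (by
    rw [Ne, compl_eq_univ_iff]; exact hR.ne_empty)
  have h3 := hQR.sixChi_union
  have h4 := sixChi_add_compl (S := S) T
  have h5 := sixChi_add_compl (S := S) Q
  have h6 := sixChi_add_compl (S := S) R
  rw [hU] at h4
  have := hT.2
  linarith

lemma disc_of_conn_of_compl_conn {T : Finset V} (hT : S.Conn T) (hT' : S.Conn Tᶜ) : S.Disc T := by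
  refine ⟨hT, ?_⟩
  have h1 := hT.sixChi_le (by
    rintro rfl; simpa using hT'.1)
  have h2 := hT'.sixChi_le (by rw [Ne, compl_eq_univ_iff]; exact hT.1.ne_empty)
  have := sixChi_add_compl (S := S) T
  linarith

/-! ### Discs without cut vertices -/

/-- `T` has at least two vertices and removing a rim vertex never disconnects it. -/
def NoCut (S : FiveSixSphere V) (T : Finset V) : Prop :=
  2 ≤ #T ∧ ∀ v ∈ S.rim T, S.Conn (T.erase v)

lemma Disc.erase {T : Finset V} (hT : S.Disc T) {v : V} (hv : v ∈ S.rim T)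
    (hc : S.Conn (T.erase v)) :
    S.Disc (T.erase v) ∧ S.linkArcs v T T + 2 = 2 * S.nbrs v T := by
  have h1 := hc.sixChi_le (fun h => notMem_erase v T (h ▸ mem_univ v))
  have h2 := hT.1.linkArcs_le hv hc.1
  have h3 := sixChi_erase (S := S) (rim_subset _ hv)
  have h4 := hT.2
  exact ⟨⟨hc, by linarith⟩, by linarith⟩

/-- Around a rim vertex `v` the cells of `T` form a single arc, so exactly two edges of the link of
`v` lead out of `T`. -/
lemma NoCut.linkArcs_compl {T : Finset V} (h : S.NoCut T) (hT : S.Disc T) {v : V}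
    (hv : v ∈ S.rim T) : S.linkArcs v T Tᶜ = 2 := by
  have h1 := (hT.erase hv (h.2 v hv)).2
  have h2 := linkArcs_add_compl (S := S) v T T
  linarith

lemma linkArcs_eq_zero_of_notMem_rim {T : Finset V} {v : V} (hv : v ∈ T) (hv' : v ∉ S.rim T)
    (P : Finset V) : S.linkArcs v P Tᶜ = 0 :=
  sum_eq_zero fun _ _ => sum_eq_zero fun y hy => triInd_of_not_tri fun ht =>
    hv' (mem_rim.2 ⟨hv, y, mem_compl.1 hy, adj_of_tri' ht⟩)

lemma sum_rim {T : Finset V} (f : V → ℤ) (hf : ∀ v ∈ T, v ∉ S.rim T → f v = 0) :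
    ∑ v ∈ T, f v = ∑ v ∈ S.rim T, f v :=
  (sum_subset (rim_subset T) hf).symm

lemma NoCut.tris_eq {T : Finset V} (h : S.NoCut T) (hT : S.Disc T) :
    S.tris T T Tᶜ = 2 * (#(S.rim T) : ℤ) := by
  rw [tris, sum_rim _ fun v hv hv' => linkArcs_eq_zero_of_notMem_rim hv hv' T,
    sum_congr rfl fun v hv => h.linkArcs_compl hT hv, sum_const]
  simp; ring

lemma NoCut.perim_eq {T : Finset V} (h : S.NoCut T) (hT : S.Disc T) :
    S.perim T = 2 * (#(S.rim T) : ℤ) + 6 - S.pent T := by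
  have h1 := sixChi_eq (S := S) T
  have := h.tris_eq hT
  have := hT.2
  linarith

/-- At most half of the rim consists of pentagons: each rim cell takes part in two corners at which
two cells of the disc meet on the boundary, and at such a corner at most one of them is a
pentagon. -/
lemma NoCut.two_mul_pent_rim_le {T : Finset V} (h : S.NoCut T) (hT : S.Disc T) :
    2 * S.pent (S.rim T) ≤ #(S.rim T) := by
  have h1 : ∑ x ∈ T, S.defect x * S.linkArcs x T Tᶜ = 2 * S.pent (S.rim T) := by
    rw [sum_rim _ fun v hv hv' => by rw [linkArcs_eq_zero_of_notMem_rim hv hv' T, mul_zero],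
      sum_congr rfl fun v hv => by rw [h.linkArcs_compl hT hv], pent, mul_sum]
    exact sum_congr rfl fun _ _ => mul_comm _ _
  have h2 : ∑ x ∈ T, S.defect x * S.linkArcs x T Tᶜ =
      ∑ x ∈ T, ∑ y ∈ T, ∑ z ∈ Tᶜ, S.defect x * S.triInd x y z := by
    simp only [linkArcs, mul_sum]
  -- the same sum, with the defect taken at the other vertex of the corner
  have h3 : ∑ x ∈ T, S.defect x * S.linkArcs x T Tᶜ =
      ∑ x ∈ T, ∑ y ∈ T, ∑ z ∈ Tᶜ, S.defect y * S.triInd x y z := by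
    rw [h2, sum_comm]
    exact sum_congr rfl fun x _ => sum_congr rfl fun y _ => sum_congr rfl fun z _ => by
      rw [triInd_swap]
  have h4 : ∑ x ∈ T, ∑ y ∈ T, ∑ z ∈ Tᶜ, (S.defect x + S.defect y) * S.triInd x y z ≤
      S.tris T T Tᶜ := by
    refine sum_le_sum fun x _ => sum_le_sum fun y _ => sum_le_sum fun z _ => ?_
    by_cases ht : S.Tri x y z
    · rw [triInd_of_tri ht, mul_one]; exact defect_add_le (S.adj_of_tri ht)
    · rw [triInd_of_not_tri ht, mul_zero]
  simp only [add_mul, sum_add_distrib] at h4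
  rw [← h2, ← h3, h1, h.tris_eq hT] at h4
  linarith

/-! ### Counting pentagons; discs with at most six cells -/

lemma pent_nonneg (T : Finset V) : 0 ≤ S.pent T :=
  sum_nonneg fun x _ => by rcases defect_eq (S := S) x with h | h <;> simp [h]

lemma pent_le_card (T : Finset V) : S.pent T ≤ #T := by
  have : S.pent T ≤ ∑ x ∈ T, 1 :=
    sum_le_sum fun x _ => by rcases defect_eq (S := S) x with h | h <;> simp [h]
  simpa using this

lemma pent_mono {P T : Finset V} (h : P ⊆ T) : S.pent P ≤ S.pent T :=
  sum_le_sum_of_subset_of_nonneg h fun x _ _ => by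
    rcases defect_eq (S := S) x with h | h <;> simp [h]

/-- Two adjacent vertices are not both pentagons, so not all cells are pentagons. -/
lemma Conn.pent_lt_card {T : Finset V} (hT : S.Conn T) (h2 : 2 ≤ #T) : S.pent T < #T := by
  obtain ⟨v, hv⟩ := hT.1
  obtain ⟨x, hx, ha⟩ := hT.exists_adj hv (card_pos.1 (by rw [card_erase_of_mem hv]; omega))
  have hvx : v ≠ x := by rintro rfl; exact S.adj_irrefl _ ha
  have h3 := pent_le_card (S := S) ((T.erase v).erase x)
  have h4 := pent_erase (S := S) hv
  have hx' : x ∈ T.erase v := mem_erase.2 ⟨hvx.symm, hx⟩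
  have h5 := pent_erase (S := S) hx'
  have h6 := defect_add_le ha
  rw [card_erase_of_mem hx', card_erase_of_mem hv] at h3
  have : ((#T - 1 - 1 : ℕ) : ℤ) = #T - 2 := by omega
  linarith

lemma nbrs_le_card (v : V) (P : Finset V) : S.nbrs v P ≤ #P := by
  have : S.nbrs v P ≤ ∑ x ∈ P, 1 :=
    sum_le_sum fun x _ => by unfold adjInd; split_ifs <;> simp
  simpa using this

lemma nbrs_interior {T : Finset V} {v : V} (hv : v ∈ T) (hv' : v ∉ S.rim T) :
    S.nbrs v (T.erase v) = S.nbrs v univ := by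
  have h1 := nbrs_add_compl (S := S) v T
  have h2 : S.nbrs v Tᶜ = 0 := sum_eq_zero fun y hy => adjInd_of_not_adj fun ha =>
    hv' (mem_rim.2 ⟨hv, y, mem_compl.1 hy, ha⟩)
  have h3 : S.nbrs v (T.erase v) + S.adjInd v v = S.nbrs v T := sum_erase_add _ _ hv
  rw [adjInd_self] at h3
  linarith

/-- An interior vertex has all of its at least five neighbours in `T`. -/
lemma card_of_interior {T : Finset V} {v : V} (hv : v ∈ T) (hv' : v ∉ S.rim T) :
    (6 : ℤ) ≤ #T := by
  have h1 := nbrs_interior hv hv'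
  have h2 := nbrs_le_card (S := S) v (T.erase v)
  have h3 := nbrs_univ (S := S) v
  have h4 := card_erase_add_one hv
  omega

lemma card_rim_of_card_le_five {T : Finset V} (h : #T ≤ 5) : S.rim T = T := by
  refine (rim_subset T).antisymm fun v hv => ?_
  by_contra hv'
  have := card_of_interior hv hv'
  omega

/-- Among six cells, an interior one is a pentagon surrounded by the other five. -/
lemma interior_of_card_six {T : Finset V} (h : #T = 6) {v : V} (hv : v ∈ T) (hv' : v ∉ S.rim T) :
    S.defect v = 1 ∧ ∀ x ∈ T, x ≠ v → S.Adj v x := by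
  have h1 := nbrs_interior hv hv'
  have h2 := nbrs_le_card (S := S) v (T.erase v)
  have h3 := nbrs_univ (S := S) v
  have h4 := card_erase_add_one hv
  have h5 : S.nbrs v (T.erase v) = 5 := by omega
  refine ⟨by unfold defect; omega, fun x hx hxv => ?_⟩
  by_contra ha
  have hx' : x ∈ T.erase v := mem_erase.2 ⟨hxv, hx⟩
  have h6 : S.nbrs v ((T.erase v).erase x) + S.adjInd v x = S.nbrs v (T.erase v) :=
    sum_erase_add _ _ hx'
  rw [adjInd_of_not_adj ha] at h6
  have h7 := nbrs_le_card (S := S) v ((T.erase v).erase x)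
  have h8 := card_erase_add_one hx'
  omega

/-- A disc of six cells without cut vertices has perimeter at least fifteen. Either all cells lie on
the rim, and at most three are pentagons, or it is a pentagon surrounded by five hexagons. -/
lemma NoCut.perim_six {T : Finset V} (h : S.NoCut T) (hT : S.Disc T) (h6 : #T = 6) :
    15 ≤ S.perim T := by
  have hp := h.perim_eq hT
  have hq := h.two_mul_pent_rim_le hT
  by_cases hr : S.rim T = T
  · rw [hr] at hp hq
    rw [h6] at hp hq
    push_cast at hp hq
    omega
  · obtain ⟨v, hv, hv'⟩ : ∃ v ∈ T, v ∉ S.rim T := by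
      by_contra! hc
      exact hr ((rim_subset T).antisymm hc)
    obtain ⟨hd, ha⟩ := interior_of_card_six h6 hv hv'
    have hrim : S.rim T = T.erase v := by
      refine subset_antisymm (fun x hx => mem_erase.2 ⟨by rintro rfl; exact hv' hx,
        rim_subset _ hx⟩) fun x hx => ?_
      rw [mem_erase] at hx
      by_contra hx'
      have h1 := (interior_of_card_six h6 hx.2 hx').1
      have h2 := defect_add_le (ha x hx.2 hx.1)
      omega
    have hp1 : S.pent (T.erase v) = 0 := sum_eq_zero fun x hx => by
      rw [mem_erase] at hx
      have h2 := defect_add_le (ha x hx.2 hx.1)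
      have := defect_eq (S := S) x
      omega
    have hp2 := pent_erase (S := S) hv
    have hc := card_erase_add_one hv
    rw [hrim] at hp
    omega

/-! ### Removing the outer ring of cells -/

/-- A rim vertex `v` has at least two neighbours on the rim, one at each end of the arc of its link
that lies in `T`. If there were only one, `x`, then both link edges leaving `T` start at `x`, so
the rest of the arc would be cut off from `x` in the link. -/
lemma NoCut.two_le_nbrs_rim {T : Finset V} (h : S.NoCut T) (hT : S.Disc T) {v : V}
    (hv : v ∈ S.rim T) (h2 : 2 ≤ S.nbrs v T) : 2 ≤ S.nbrs v (S.rim T) := by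
  by_contra! hlt
  have hl := h.linkArcs_compl hT hv
  obtain ⟨x, hx, hlx⟩ : ∃ x ∈ T, ∑ z ∈ Tᶜ, S.triInd v x z ≠ 0 := by
    by_contra! hc
    rw [linkArcs, sum_eq_zero hc] at hl
    norm_num at hl
  obtain ⟨z, hz, ht⟩ : ∃ z ∈ Tᶜ, S.Tri v x z := by
    by_contra! hc
    exact hlx (sum_eq_zero fun z hz => triInd_of_not_tri (hc z hz))
  have rim_of : ∀ y ∈ T, ∀ w ∉ T, S.Tri v y w → y ∈ S.rim T := fun y hy w hw hvw =>
    mem_rim.2 ⟨hy, w, hw, adj_of_tri'' hvw⟩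
  have hxr := rim_of x hx z (mem_compl.1 hz) ht
  -- `x` is the only neighbour of `v` on the rim
  have uniq : ∀ y ∈ S.rim T, S.Adj v y → y = x := by
    intro y hy ha
    by_contra hyx
    have hsub : ({x, y} : Finset V) ⊆ S.rim T := by
      simp [insert_subset_iff, hxr, hy]
    have h3 : S.nbrs v {x, y} ≤ S.nbrs v (S.rim T) :=
      sum_le_sum_of_subset_of_nonneg hsub fun _ _ _ => adjInd_nonneg _ _
    rw [nbrs, sum_pair (Ne.symm hyx), adjInd_of_adj ha, adjInd_of_adj (S.adj_of_tri ht)] at h3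
    linarith
  have hzero : ∀ y ∈ T, y ≠ x → ∑ w ∈ Tᶜ, S.triInd v y w = 0 := fun y hy hyx =>
    sum_eq_zero fun w hw => triInd_of_not_tri fun hvw =>
      hyx (uniq y (rim_of y hy w (mem_compl.1 hw) hvw) (S.adj_of_tri hvw))
  have hx2 : ∑ w ∈ Tᶜ, S.triInd v x w = 2 := by
    rw [← hl, linkArcs, sum_eq_single_of_mem x hx hzero]
  have hxT : ∑ w ∈ T, S.triInd v x w = 0 := by
    have h3 := sum_add_sum_compl T fun w => S.triInd v x w
    rw [sum_triInd, adjInd_of_adj (S.adj_of_tri ht)] at h3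
    linarith
  obtain ⟨y, hy, w, hw, hvw⟩ := S.link_cut v (T.erase x) (by
    by_contra! hc
    have h3 : S.nbrs v (T.erase x) + S.adjInd v x = S.nbrs v T := sum_erase_add _ _ hx
    have h4 : S.nbrs v (T.erase x) = 0 := sum_eq_zero fun y hy => adjInd_of_not_adj (hc y hy)
    rw [adjInd_of_adj (S.adj_of_tri ht)] at h3
    linarith) ⟨x, by simp, S.adj_of_tri ht⟩
  rw [mem_erase] at hy hw
  by_cases hwT : w ∈ T
  · have hwx : w = x := by
      by_contra hwx
      exact hw ⟨hwx, hwT⟩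
    subst hwx
    have h5 := sum_pos' (f := fun u => S.triInd v w u) (fun _ _ => triInd_nonneg _ _ _)
      ⟨y, hy.2, by rw [triInd_of_tri (S.tri_swap' hvw)]; norm_num⟩
    exact absurd hxT h5.ne'
  · exact hy.1 (uniq y (rim_of y hy.2 w hwT hvw) (S.adj_of_tri hvw))

/-- If the complement of `T` is connected, it remains so after the rim of `T` is added to it. -/
lemma Conn.compl_sdiff_rim {T : Finset V} (hT : S.Conn Tᶜ) : S.Conn (T \ S.rim T)ᶜ := by
  have hE : (T \ S.rim T)ᶜ = Tᶜ ∪ S.rim T := by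
    ext x; simp; tauto
  obtain ⟨v, hv⟩ := hT.1
  rw [hE]
  refine conn_of_pointed (mem_union_left _ hv) fun Q hQ hvQ hne => ?_
  by_cases hd : ∃ x ∈ Q, x ∈ Tᶜ
  · obtain ⟨x, hx, hxT⟩ := hd
    obtain ⟨x, hx, y, hy, hyQ, ha⟩ := hT.2 (Q ∩ Tᶜ) inter_subset_right
      ⟨x, mem_inter.2 ⟨hx, hxT⟩⟩ (fun he => hvQ (mem_of_mem_inter_left (he.symm ▸ hv)))
    exact ⟨x, mem_of_mem_inter_left hx, y, mem_union_left _ hy,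
      fun h => hyQ (mem_inter.2 ⟨h, hy⟩), ha⟩
  · push Not at hd
    obtain ⟨x, hx⟩ := hne
    have hxr := (mem_union.1 (hQ hx)).resolve_left (hd x hx)
    obtain ⟨-, y, hy, ha⟩ := mem_rim.1 hxr
    exact ⟨x, hx, y, mem_union_left _ (mem_compl.2 hy), fun h => hd y h (mem_compl.2 hy), ha⟩

lemma perim_sdiff_rim (T : Finset V) :
    S.perim (T \ S.rim T) = ∑ v ∈ S.rim T, S.nbrs v (T \ S.rim T) := by
  have h1 : S.perim (T \ S.rim T) = S.arcs (T \ S.rim T)ᶜ (T \ S.rim T) := arcs_comm _ _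
  rw [h1, arcs]
  refine (sum_subset (fun x hx => by simp [hx]) fun x hx hx' => ?_).symm
  refine sum_eq_zero fun y hy => adjInd_of_not_adj fun ha => ?_
  rw [mem_sdiff] at hy
  rw [mem_compl, mem_sdiff] at hx
  exact hy.2 (mem_rim.2 ⟨hy.1, x, by tauto, S.adj_symm ha⟩)

/-- A lower bound for the perimeter in terms of the number of pentagons passes from discs to sets
with connected complement, whose components are discs. It does so because
`p ↦ min (5 * p) (p + 9)` is subadditive. -/
lemma perim_of_compl_conn {n : ℕ} (ih : ∀ C : Finset V, #C < n → S.Disc C → S.pent C ≤ 6 →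
      5 * S.pent C ≤ S.perim C ∨ S.pent C + 9 ≤ S.perim C)
    {W : Finset V} (hW : #W < n) (hne : W.Nonempty) (hc : S.Conn Wᶜ) (hp : S.pent W ≤ 6) :
    5 * S.pent W ≤ S.perim W ∨ S.pent W + 9 ≤ S.perim W := by
  induction hm : #W using Nat.strong_induction_on generalizing W with
  | _ m ih2 =>
  by_cases hWc : S.Conn W
  · exact ih W hW (disc_of_conn_of_compl_conn hWc hc) hp
  · obtain ⟨Q, R, hQ, hR, hQR, rfl⟩ := exists_apart hne hWc
    have hcard := card_union_of_disjoint hQR.1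
    have hQ0 := hQ.card_pos
    have hR0 := hR.card_pos
    have hpU := pent_union (S := S) hQR.1
    have hpQ := pent_nonneg (S := S) Q
    have hpR := pent_nonneg (S := S) R
    have h1 := ih2 #Q (by omega) (by omega) hQ (hc.compl_of_apart hQR) (by omega) rfl
    have h2 := ih2 #R (by omega) (by omega) hR
      (Conn.compl_of_apart (by rwa [union_comm]) hQR.symm) (by omega) rfl
    have h3 := hQR.perim_union
    omega

/-! ### The isoperimetric inequality -/

/-- The bounds on the perimeter that are proved together by induction. The second holds with equality
for small discs without cut vertices; the third controls the inside of an outer ring of cells. -/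
def Bounds (S : FiveSixSphere V) (T : Finset V) : Prop :=
  (6 ≤ #T → 15 ≤ S.perim T) ∧
  (2 ≤ #T → #T ≤ 5 → 2 * (#T : ℤ) + 6 ≤ S.perim T + S.pent T) ∧
  (5 * S.pent T ≤ S.perim T ∨ S.pent T + 9 ≤ S.perim T)

/-- The inductive step for a disc of at least seven cells without cut vertices. If a cell has at
least half of its sides on the boundary, removing it does not lengthen the boundary. Otherwise
each rim cell has at most two boundary sides, and Gauss–Bonnet forces exactly two for each, six
pentagons, and a rim of at most seven cells if the perimeter is less than fifteen. At most three
of the pentagons lie on the rim, so what remains after removing the rim has at least three, and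
its perimeter is too short for that. -/
lemma NoCut.fifteen_le {T : Finset V} (h : S.NoCut T) (hT : S.Disc T) (hp : S.pent T ≤ 6)
    (ih : ∀ C : Finset V, #C < #T → S.Disc C → S.pent C ≤ 6 → S.Bounds C) (h7 : 7 ≤ #T) :
    15 ≤ S.perim T := by
  by_contra! hlt
  -- otherwise removing `v` yields a disc whose boundary is not longer
  have hk : ∀ v ∈ S.rim T, S.nbrs v Tᶜ ≤ 2 := by
    intro v hv
    by_contra! hk
    have h1 := perim_erase (S := S) (rim_subset _ hv)
    have h2 := nbrs_add_compl (S := S) v T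
    have h3 := nbrs_univ (S := S) v
    have h4 := card_erase_add_one (rim_subset _ hv)
    have h5 := (ih (T.erase v) (by omega) (hT.erase hv (h.2 v hv)).1
      ((pent_mono (erase_subset _ _)).trans hp)).1 (by omega)
    omega
  have hb := h.perim_eq hT
  have hq := h.two_mul_pent_rim_le hT
  have hsum : S.perim T = ∑ v ∈ S.rim T, S.nbrs v Tᶜ := sum_rim _ fun v hv hv' =>
    sum_eq_zero fun y hy => adjInd_of_not_adj fun ha =>
      hv' (mem_rim.2 ⟨hv, y, mem_compl.1 hy, ha⟩)
  have hle : ∑ v ∈ S.rim T, S.nbrs v Tᶜ ≤ ∑ v ∈ S.rim T, 2 := sum_le_sum hk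
  -- Gauss–Bonnet gives `2 * #(rim T) ≤ perim T`, so equality holds for each rim vertex
  have hk2 : ∀ v ∈ S.rim T, S.nbrs v Tᶜ = 2 := by
    refine (sum_eq_sum_iff_of_le hk).1 (hle.antisymm ?_)
    rw [← hsum, sum_const]
    simp only [nsmul_eq_mul]
    linarith
  rw [sum_const, ← hsum] at hle
  simp only [nsmul_eq_mul] at hle
  -- of its `6 - defect v - 2` neighbours in `T`, a rim vertex `v` has at least two on the rim
  have hring : S.perim (T \ S.rim T) ≤ 2 * (#(S.rim T) : ℤ) - S.pent (S.rim T) := by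
    rw [perim_sdiff_rim]
    have : ∑ v ∈ S.rim T, S.nbrs v (T \ S.rim T) ≤ ∑ v ∈ S.rim T, (2 - S.defect v) := by
      refine sum_le_sum fun v hv => ?_
      have h1 := nbrs_add_compl (S := S) v T
      have h2 := nbrs_univ (S := S) v
      have h3 := hk2 v hv
      have h4 := h.two_le_nbrs_rim hT hv (by omega)
      have h5 : S.nbrs v (T \ S.rim T) + S.nbrs v (S.rim T) = S.nbrs v T :=
        sum_sdiff (rim_subset T)
      unfold defect
      omega
    rw [sum_sub_distrib, sum_const, ← pent] at this
    simp only [nsmul_eq_mul] at this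
    linarith
  have hpe : S.pent (T \ S.rim T) + S.pent (S.rim T) = S.pent T := sum_sdiff (rim_subset T)
  have hne : (T \ S.rim T).Nonempty := by
    rw [nonempty_iff_ne_empty]
    intro he
    rw [he, pent, sum_empty] at hpe
    omega
  have hcard : #(T \ S.rim T) < #T :=
    card_lt_card (sdiff_ssubset (rim_subset T) (rim_nonempty hT.1.1 hT.ne_univ))
  have := perim_of_compl_conn (fun C hC hCd hCp => (ih C hC hCd hCp).2.2) hcard hne
    hT.compl_conn.compl_sdiff_rim ((pent_mono sdiff_subset).trans hp)
  omega

lemma bounds_singleton (v : V) : S.Bounds {v} := by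
  have h1 := arcs_add_perim (S := S) {v}
  have h2 : S.arcs {v} {v} = 0 := by simp [arcs, nbrs]
  have h3 : S.pent {v} = S.defect v := sum_singleton _ _
  have h4 := defect_eq (S := S) v
  rw [card_singleton] at h1
  refine ⟨by simp, by simp, ?_⟩
  omega

/-- Induction on the number of cells. A cut vertex `v` splits the disc into two discs that share the
cell `v`, whose perimeters add up to that of the whole plus the degree of `v`. -/
lemma Disc.bounds {T : Finset V} (hT : S.Disc T) (hp : S.pent T ≤ 6) : S.Bounds T := by
  induction hn : #T using Nat.strong_induction_on generalizing T with
  | _ n ih =>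
  have ih' : ∀ C : Finset V, #C < #T → S.Disc C → S.pent C ≤ 6 → S.Bounds C :=
    fun C hC hd hCp => ih #C (hn ▸ hC) hd hCp rfl
  have hT0 := hT.1.1.card_pos
  by_cases h1 : #T = 1
  · obtain ⟨v, rfl⟩ := card_eq_one.1 h1
    exact bounds_singleton v
  have hlt := hT.1.pent_lt_card (by omega)
  have hpn := pent_nonneg (S := S) T
  by_cases hcut : S.NoCut T
  · have hb := hcut.perim_eq hT
    have hq := hcut.two_mul_pent_rim_le hT
    rcases Nat.lt_or_ge #T 6 with h6 | h6
    · rw [card_rim_of_card_le_five (by omega)] at hb hq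
      unfold Bounds
      omega
    · have h15 : 15 ≤ S.perim T := by
        rcases h6.eq_or_lt with h6 | h6
        · exact hcut.perim_six hT h6.symm
        · exact hcut.fifteen_le hT hp ih' h6
      unfold Bounds
      omega
  · simp only [NoCut, not_and, not_forall] at hcut
    obtain ⟨v, hv, hc⟩ := hcut (by omega)
    have hvT := rim_subset _ hv
    obtain ⟨P, R, hP, hR, hvP, hvR, hPR, hTe, cP, cR⟩ := hT.1.exists_split hvT
      (card_pos.1 (by rw [card_erase_of_mem hvT]; omega)) hc
    have hcard := card_insert_of_notMem (s := P ∪ R) (a := v) (by simp [hvP, hvR])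
    rw [card_union_of_disjoint hPR.1, ← hTe] at hcard
    have hcP := card_insert_of_notMem hvP
    have hcR := card_insert_of_notMem hvR
    have hP0 := hP.card_pos
    have hR0 := hR.card_pos
    have hX := hPR.sixChi_insert_union hvP hvR
    have hB := hPR.perim_insert_union hvP hvR
    rw [← hTe] at hX hB
    have hTn : #T ≠ #(insert v P) ∧ #T ≠ #(insert v R) := by omega
    have hXP := cP.sixChi_le (fun h => by
      have := card_le_univ T; rw [← card_univ, ← h] at this; omega)
    have hXR := cR.sixChi_le (fun h => by
      have := card_le_univ T; rw [← card_univ, ← h] at this; omega)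
    have hX6 := hT.2
    have dP : S.Disc (insert v P) := ⟨cP, by omega⟩
    have dR : S.Disc (insert v R) := ⟨cR, by omega⟩
    have hpP : S.pent (insert v P) = S.defect v + S.pent P := sum_insert hvP
    have hpR : S.pent (insert v R) = S.defect v + S.pent R := sum_insert hvR
    have hpT : S.pent T = S.defect v + (S.pent P + S.pent R) := by
      rw [hTe, pent, sum_insert (by simp [hvP, hvR]), sum_union hPR.1]; rfl
    have hP1 := pent_nonneg (S := S) P
    have hR1 := pent_nonneg (S := S) R
    obtain ⟨a1, a2, -⟩ := ih' _ (by omega) dP (by omega)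
    obtain ⟨b1, b2, -⟩ := ih' _ (by omega) dR (by omega)
    have hlP := cP.pent_lt_card (by omega)
    have hlR := cR.pent_lt_card (by omega)
    have hdv : S.defect v = 6 - S.nbrs v univ := rfl
    have hd := defect_eq (S := S) v
    unfold Bounds
    omega

end FiveSixSphere

/-! ### Counting simplices by ordered tuples -/

section Counting
variable {V : Type*} [Fintype V] [DecidableEq V]

lemma ncard_setOf (p : V → Prop) [DecidablePred p] : {x | p x}.ncard = #{x | p x} := by
  rw [← Set.ncard_coe_finset]; congr 1; ext; simp

lemma sum_sum_mem (s t : Finset V) (f : V → V → ℤ) :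
    ∑ x ∈ s, ∑ y ∈ t, f x y = ∑ x, ∑ y, if x ∈ s ∧ y ∈ t then f x y else 0 := by
  rw [← sum_subset (subset_univ s)]
  · exact sum_congr rfl fun x hx => by simp [hx]
  · intro x _ hx
    simp [hx]

open scoped Classical in
lemma ncard_vertices (A : Set (Finset V)) :
    ({σ ∈ A | σ.card = 1}.ncard : ℤ) = ∑ x : V, if ({x} : Finset V) ∈ A then 1 else 0 := by
  have : {σ ∈ A | σ.card = 1} = (fun x : V => ({x} : Finset V)) '' {x | ({x} : Finset V) ∈ A} := by
    ext σ
    simp only [Set.mem_ofPred_eq, Set.mem_image, card_eq_one]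
    constructor
    · rintro ⟨h, x, rfl⟩; exact ⟨x, h, rfl⟩
    · rintro ⟨x, h, rfl⟩; exact ⟨h, x, rfl⟩
  rw [this, Set.ncard_image_of_injective _ singleton_injective, sum_boole,
    Set.ncard_eq_toFinset_card']
  simp

open scoped Classical in
lemma two_mul_ncard_edges (A : Set (Finset V)) :
    2 * ({σ ∈ A | σ.card = 2}.ncard : ℤ) =
      ∑ x : V, ∑ y : V, if x ≠ y ∧ ({x, y} : Finset V) ∈ A then 1 else 0 := by
  have h1 : (∑ x : V, ∑ y : V, if x ≠ y ∧ ({x, y} : Finset V) ∈ A then (1 : ℤ) else 0) =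
      #{p : V × V | p.1 ≠ p.2 ∧ ({p.1, p.2} : Finset V) ∈ A} := by
    rw [← Fintype.sum_prod_type', sum_boole]
  rw [h1, card_eq_sum_card_fiberwise (f := fun p : V × V => ({p.1, p.2} : Finset V))
    (t := ({σ ∈ A | σ.card = 2} : Set (Finset V)).toFinset)]
  · rw [sum_congr rfl (g := fun _ => 2), sum_const, Set.ncard_eq_toFinset_card']
    · simp; ring
    · intro σ hσ
      simp only [Set.mem_toFinset, Set.mem_ofPred_eq] at hσ
      obtain ⟨hσ, hc⟩ := hσ
      obtain ⟨a, b, hab, rfl⟩ := card_eq_two.1 hc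
      have : ({p ∈ ({p : V × V | p.1 ≠ p.2 ∧ ({p.1, p.2} : Finset V) ∈ A} : Finset _) |
          ({p.1, p.2} : Finset V) = {a, b}}) = {(a, b), (b, a)} := by
        ext ⟨x, y⟩
        simp only [mem_filter, mem_univ, true_and, mem_insert, mem_singleton, Prod.mk.injEq]
        constructor
        · rintro ⟨⟨hxy, -⟩, h⟩
          have hx : x ∈ ({a, b} : Finset V) := h ▸ by simp
          have hy : y ∈ ({a, b} : Finset V) := h ▸ by simp
          simp only [mem_insert, mem_singleton] at hx hy
          grind
        · rintro (⟨rfl, rfl⟩ | ⟨rfl, rfl⟩)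
          · exact ⟨⟨hab, hσ⟩, rfl⟩
          · exact ⟨⟨hab.symm, by rwa [pair_comm]⟩, pair_comm _ _⟩
      rw [this, card_pair (by simp [hab])]
  · rintro ⟨x, y⟩ h
    simp only [coe_filter, mem_univ, true_and, Set.mem_ofPred_eq] at h
    simp only [Set.coe_toFinset, Set.mem_ofPred_eq]
    exact ⟨h.2, card_pair h.1⟩

open scoped Classical in
lemma six_mul_ncard_triangles (A : Set (Finset V)) :
    6 * ({σ ∈ A | σ.card = 3}.ncard : ℤ) =
      ∑ x : V, ∑ y : V, ∑ z : V,
        if x ≠ y ∧ x ≠ z ∧ y ≠ z ∧ ({x, y, z} : Finset V) ∈ A then 1 else 0 := by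
  have h1 : (∑ x : V, ∑ y : V, ∑ z : V,
        if x ≠ y ∧ x ≠ z ∧ y ≠ z ∧ ({x, y, z} : Finset V) ∈ A then (1 : ℤ) else 0) =
      #{p : V × V × V | p.1 ≠ p.2.1 ∧ p.1 ≠ p.2.2 ∧ p.2.1 ≠ p.2.2 ∧
        ({p.1, p.2.1, p.2.2} : Finset V) ∈ A} := by
    simp only [← sum_boole, Fintype.sum_prod_type]
  rw [h1, card_eq_sum_card_fiberwise (f := fun p : V × V × V => ({p.1, p.2.1, p.2.2} : Finset V))
    (t := ({σ ∈ A | σ.card = 3} : Set (Finset V)).toFinset)]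
  · rw [sum_congr rfl (g := fun _ => 6), sum_const, Set.ncard_eq_toFinset_card']
    · simp; ring
    · intro σ hσ
      simp only [Set.mem_toFinset, Set.mem_ofPred_eq] at hσ
      obtain ⟨hσ, hc⟩ := hσ
      obtain ⟨a, b, c, hab, hac, hbc, rfl⟩ := card_eq_three.1 hc
      have : ({p ∈ ({p : V × V × V | p.1 ≠ p.2.1 ∧ p.1 ≠ p.2.2 ∧ p.2.1 ≠ p.2.2 ∧
          ({p.1, p.2.1, p.2.2} : Finset V) ∈ A} : Finset _) |
          ({p.1, p.2.1, p.2.2} : Finset V) = {a, b, c}}) =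
          {(a, b, c), (a, c, b), (b, a, c), (b, c, a), (c, a, b), (c, b, a)} := by
        ext ⟨x, y, z⟩
        simp only [mem_filter, mem_univ, true_and, mem_insert, mem_singleton, Prod.mk.injEq]
        constructor
        · rintro ⟨⟨hxy, hxz, hyz, -⟩, h⟩
          have hx : x ∈ ({a, b, c} : Finset V) := h ▸ by simp
          have hy : y ∈ ({a, b, c} : Finset V) := h ▸ by simp
          have hz : z ∈ ({a, b, c} : Finset V) := h ▸ by simp
          simp only [mem_insert, mem_singleton] at hx hy hz
          grind
        · intro h
          have he : ({x, y, z} : Finset V) = {a, b, c} := by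
            ext w; simp only [mem_insert, mem_singleton]; grind
          refine ⟨⟨?_, ?_, ?_, he ▸ hσ⟩, he⟩ <;> grind
      rw [this, card_insert_of_notMem, card_insert_of_notMem, card_insert_of_notMem,
        card_insert_of_notMem, card_pair] <;>
      simp [hab, hac, hbc, hab.symm, hac.symm, hbc.symm]
  · rintro ⟨x, y, z⟩ h
    simp only [coe_filter, mem_univ, true_and, Set.mem_ofPred_eq] at h
    simp only [Set.coe_toFinset, Set.mem_ofPred_eq]
    exact ⟨h.2.2.2, card_eq_three.2 ⟨x, y, z, h.1, h.2.1, h.2.2.1, rfl⟩⟩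

open scoped Classical in
lemma six_mul_eulerChar (A : Set (Finset V)) :
    6 * eulerChar A = 6 * (∑ x : V, if ({x} : Finset V) ∈ A then 1 else 0)
      - 3 * (∑ x : V, ∑ y : V, if x ≠ y ∧ ({x, y} : Finset V) ∈ A then 1 else 0)
      + ∑ x : V, ∑ y : V, ∑ z : V,
        if x ≠ y ∧ x ≠ z ∧ y ≠ z ∧ ({x, y, z} : Finset V) ∈ A then 1 else 0 := by
  rw [← ncard_vertices, ← two_mul_ncard_edges, ← six_mul_ncard_triangles, eulerChar]
  ring

end Counting

/-! ### From complexes to adjacency relations -/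

lemma connected_exists_adj {α : Type*} {G : SimpleGraph α} (hG : G.Connected) (s : Set α)
    {a b : α} (ha : a ∈ s) (hb : b ∉ s) : ∃ x ∈ s, ∃ y ∉ s, G.Adj x y := by
  obtain ⟨p⟩ := hG.preconnected a b
  obtain ⟨d, -, h1, h2⟩ := p.exists_boundary_dart s ha hb
  exact ⟨d.fst, h1, d.snd, h2, d.adj⟩

section Complex
variable {V : Type*} [DecidableEq V] {K : AbstractSimplicialComplex V}

lemma mem_of_subset_face {σ τ : Finset V} (hσ : σ ∈ K) (h : τ ⊆ σ) (hne : τ.Nonempty) : τ ∈ K :=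
  (K.isRelLowerSet_faces hσ).2 h hne

/-- Let every cell of the connected set `A` contain a vertex of `T`, and let `A` contain `T`. Then the
edges of `K` connect `T`: a cell meeting `P ⊆ T` can meet no vertex of `T` outside `P` unless an
edge leaves `P`, so otherwise the cells that meet `P` would form a union of components. -/
lemma IsConnected.exists_adj_crossing {A : Set (Finset V)} (hA : IsConnected A)
    (hK : ∀ σ ∈ A, σ ∈ K) {T : Set V} (hT : ∀ σ ∈ A, ∃ v ∈ σ, v ∈ T)
    (hT' : ∀ v ∈ T, ({v} : Finset V) ∈ A) {P : Set V} (hP : P ⊆ T) {p q : V} (hp : p ∈ P)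
    (hq : q ∈ T) (hqP : q ∉ P) :
    ∃ x ∈ P, ∃ y ∈ T, y ∉ P ∧ x ≠ y ∧ ({x, y} : Finset V) ∈ K := by
  by_contra! hc
  have key : ∀ σ ∈ A, ∀ x ∈ σ, x ∈ P → ∀ y ∈ σ, y ∈ T → y ∈ P := by
    intro σ hσ x hx hxP y hy hyT
    by_contra hyP
    exact hc x hxP y hyT hyP (by rintro rfl; exact hyP hxP)
      (mem_of_subset_face (hK σ hσ) (by simp [insert_subset_iff, hx, hy]) (by simp))
  obtain ⟨⟨σ, hσ⟩, ⟨x, hx, hxP⟩, ⟨τ, hτ⟩, h2, hadj⟩ := connected_exists_adj hA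
    {σ : A | ∃ x ∈ (σ : Finset V), x ∈ P} (a := ⟨{p}, hT' p (hP hp)⟩) (b := ⟨{q}, hT' q hq⟩)
    ⟨p, by simp, hp⟩ (by simpa using hqP)
  rw [SimpleGraph.fromRel_adj] at hadj
  obtain ⟨-, h | h⟩ := hadj
  · exact h2 ⟨x, h.1 hx, hxP⟩
  · obtain ⟨y, hy, hyT⟩ := hT τ hτ
    exact h2 ⟨y, hy, key σ hσ x hx hxP y (h.1 hy) hyT⟩

lemma IsTriangulatedClosedSurface.singleton_mem (h : IsTriangulatedClosedSurface K) (v : V) :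
    ({v} : Finset V) ∈ K := by
  obtain ⟨u, -, hu⟩ := (h.link_connected v).nonempty
  exact mem_of_subset_face hu (by simp) (by simp)

lemma IsTriangulatedClosedSurface.finite_vertices (h : IsTriangulatedClosedSurface K) :
    Finite V := by
  have := h.finite_faces.to_subtype
  exact Finite.of_injective (fun v : V => (⟨{v}, h.singleton_mem v⟩ : K.faces)) fun a b hab => by
    simpa using hab

lemma IsTriangulatedClosedSurface.ncard_third (h : IsTriangulatedClosedSurface K) {x y : V}
    (hxy : x ≠ y) (hK : ({x, y} : Finset V) ∈ K) :
    {z | x ≠ y ∧ x ≠ z ∧ y ≠ z ∧ ({x, y, z} : Finset V) ∈ K}.ncard = 2 := by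
  rw [← h.link_regular x ⟨y, hxy.symm, hK⟩, ← Set.ncard_image_of_injective _ Subtype.val_injective]
  congr 1
  ext z
  simp only [Set.mem_ofPred_eq, Set.mem_image, SimpleGraph.mem_neighborSet, linkGraph]
  constructor
  · rintro ⟨-, hxz, hyz, hf⟩
    exact ⟨⟨z, hxz.symm, mem_of_subset_face hf (by simp [insert_subset_iff]) (by simp)⟩,
      ⟨fun he => hyz (congrArg Subtype.val he), hf⟩, rfl⟩
  · rintro ⟨⟨z, hz, hz'⟩, ⟨h1, h2⟩, rfl⟩
    exact ⟨hxy, hz.symm, fun he => h1 (Subtype.ext he), h2⟩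

lemma neighbors_eq (v : V) : neighbors K v = {u | v ≠ u ∧ ({v, u} : Finset V) ∈ K} := by
  ext u; simp [neighbors, ne_comm]

/-- The adjacency and triangle relations of a `5/6*`-triangulation of the sphere. -/
noncomputable def IsFiveSixStarSphere.toFiveSixSphere [Fintype V] (h : IsFiveSixStarSphere K) :
    FiveSixSphere V where
  Adj x y := x ≠ y ∧ ({x, y} : Finset V) ∈ K
  Tri x y z := x ≠ y ∧ x ≠ z ∧ y ≠ z ∧ ({x, y, z} : Finset V) ∈ K
  adj_symm := fun ⟨h1, h2⟩ => ⟨h1.symm, by rwa [pair_comm]⟩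
  adj_irrefl := fun x hx => hx.1 rfl
  tri_swap := fun ⟨h1, h2, h3, h4⟩ => ⟨h1.symm, h3, h2, by rwa [insert_comm]⟩
  tri_swap' := fun ⟨h1, h2, h3, h4⟩ => ⟨h2, h1, h3.symm, by rwa [pair_comm]⟩
  adj_of_tri := fun ⟨h1, h2, h3, h4⟩ =>
    ⟨h1, mem_of_subset_face h4 (by simp [insert_subset_iff]) (by simp)⟩
  card_tri := fun {x y} ⟨h1, h2⟩ => by
    classical
    rw [← h.ncard_third h1 h2, ncard_setOf]
    convert rfl
  link_cut := by
    rintro v P ⟨x, hxP, hvx, hx⟩ ⟨y, hyP, hvy, hy⟩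
    obtain ⟨⟨a, ha, _⟩, haP, ⟨b, hb, _⟩, hbP, hab, hf⟩ := connected_exists_adj (h.link_connected v)
      {u | (u : V) ∈ P} (a := ⟨x, hvx.symm, hx⟩) (b := ⟨y, hvy.symm, hy⟩) hxP hyP
    exact ⟨a, haP, b, hbP, ha.symm, hb.symm, fun he => hab (Subtype.ext he), hf⟩
  cut := by
    rintro P ⟨p, hp⟩ hne
    obtain ⟨q, hq⟩ : ∃ q, q ∉ P := by
      by_contra! hc
      exact hne (eq_univ_of_forall hc)
    obtain ⟨x, hx, y, -, hy, hxy⟩ := h.connected.exists_adj_crossing (K := K) (fun _ hσ => hσ)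
      (T := Set.univ) (fun σ hσ => ((K.isRelLowerSet_faces hσ).1).imp fun v hv => ⟨hv, trivial⟩)
      (fun v _ => h.singleton_mem v) (P := (P : Set V)) (Set.subset_univ _) hp trivial hq
    exact ⟨x, hx, y, hy, hxy⟩
  euler := by
    have h1 := six_mul_eulerChar K.faces
    have h2 : ∀ x : V, ({x} : Finset V) ∈ K.faces := h.singleton_mem
    simp only [h.eulerChar_eq, h2, if_true, sum_const, card_univ, nsmul_eq_mul, mul_one] at h1
    convert h1.symm <;> first | exact Iff.rfl | norm_num
  degree_eq := fun x => by
    classical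
    have := h.degree_eq x
    rw [degree, neighbors_eq, ncard_setOf] at this
    convert this
  not_adj := fun {x y} hxy hx => by
    classical
    have := h.not_adjacent x y
    rw [degree, degree, neighbors_eq, neighbors_eq, ncard_setOf, ncard_setOf] at this
    convert this (by convert hx) hxy

variable [Fintype V] (h : IsFiveSixStarSphere K)

lemma nbrs_univ_eq_degree (x : V) : h.toFiveSixSphere.nbrs x univ = degree K x := by
  classical
  rw [degree, neighbors_eq, ncard_setOf, FiveSixSphere.nbrs]
  simp only [FiveSixSphere.adjInd, sum_boole]
  congr 2
  ext u
  simp only [mem_filter]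
  exact Iff.rfl

/-! ### Dual subcomplexes -/

lemma DualSubcomplex.IsDisc.mem_cells_iff {D : DualSubcomplex K} (hD : D.IsDisc) {σ : Finset V}
    (hσ : σ ∈ K) : σ ∈ D.cells ↔ ∃ v ∈ σ, v ∈ D.twoCells :=
  ⟨hD.pure σ, fun ⟨v, hv, hvD⟩ => D.closed {v} hvD σ hσ (by simpa using hv)⟩

/-- The cells of a dual disc are the simplices that contain one of its `2`-cells `T`. The simplices
missing from it span the complement of `T`, so the Euler characteristic of `T` follows by
duality. -/
lemma disc_of_isDisc {D : DualSubcomplex K} (hD : D.IsDisc) {T : Finset V}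
    (hT : ∀ v, v ∈ T ↔ v ∈ D.twoCells) : h.toFiveSixSphere.Disc T := by
  classical
  set S := h.toFiveSixSphere
  refine ⟨⟨?_, fun P hP hne hPT => ?_⟩, ?_⟩
  · obtain ⟨σ, hσ⟩ := hD.connected.nonempty
    obtain ⟨v, -, hv⟩ := hD.pure σ hσ
    exact ⟨v, (hT v).2 hv⟩
  · obtain ⟨p, hp⟩ := hne
    obtain ⟨q, hq, hqP⟩ : ∃ q ∈ T, q ∉ P := by
      by_contra! hc
      exact hPT (hP.antisymm hc)
    obtain ⟨x, hx, y, hy, hyP, hxy⟩ := hD.connected.exists_adj_crossing D.mem_of_mem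
      (T := D.twoCells) hD.pure (fun _ hv => hv) (P := (P : Set V))
      (fun v hv => (hT v).1 (hP hv)) hp ((hT q).1 hq) hqP
    exact ⟨x, hx, y, (hT y).2 hy, hyP, hxy⟩
  · have h1 := six_mul_eulerChar D.cells
    rw [hD.eulerChar_eq] at h1
    have hmem : ∀ f : V → ℤ, ∑ x ∈ Tᶜ, f x = ∑ x, if x ∈ Tᶜ then f x else 0 :=
      fun f => by rw [sum_ite_mem, univ_inter]
    have e1 : (∑ x : V, if ({x} : Finset V) ∈ D.cells then (1 : ℤ) else 0) = #T := by
      rw [sum_boole]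
      congr 2
      ext x; simp [hT, DualSubcomplex.twoCells]
    -- the edges and triangles missing from the disc are those of the induced complex on `Tᶜ`
    have e2 : (∑ x : V, ∑ y : V, if x ≠ y ∧ ({x, y} : Finset V) ∈ D.cells then (1 : ℤ) else 0)
        + S.arcs Tᶜ Tᶜ = S.arcs univ univ := by
      simp only [FiveSixSphere.arcs, FiveSixSphere.nbrs]
      rw [sum_sum_mem Tᶜ]
      simp only [← sum_add_distrib]
      refine sum_congr rfl fun x _ => sum_congr rfl fun y _ => ?_
      by_cases ha : S.Adj x y
      · have := hD.mem_cells_iff ha.2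
        simp only [mem_insert, mem_singleton, exists_eq_or_imp, exists_eq_left, ← hT] at this
        simp only [this, FiveSixSphere.adjInd_of_adj ha, ne_eq, ha.1, mem_compl]
        split_ifs <;> first | rfl | tauto
      · rw [FiveSixSphere.adjInd_of_not_adj ha, if_neg fun hc => ha ⟨hc.1, D.mem_of_mem _ hc.2⟩]
        simp
    have e3 : (∑ x : V, ∑ y : V, ∑ z : V,
        if x ≠ y ∧ x ≠ z ∧ y ≠ z ∧ ({x, y, z} : Finset V) ∈ D.cells then (1 : ℤ) else 0)
        + S.tris Tᶜ Tᶜ Tᶜ = S.tris univ univ univ := by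
      have e4 : S.tris Tᶜ Tᶜ Tᶜ =
          ∑ x, ∑ y, ∑ z, if x ∈ Tᶜ ∧ y ∈ Tᶜ ∧ z ∈ Tᶜ then S.triInd x y z else 0 := by
        simp only [FiveSixSphere.tris, FiveSixSphere.linkArcs]
        rw [sum_sum_mem Tᶜ]
        refine sum_congr rfl fun x _ => sum_congr rfl fun y _ => ?_
        by_cases hxy : x ∈ Tᶜ ∧ y ∈ Tᶜ
        · rw [if_pos hxy, hmem]
          simp only [hxy.1, hxy.2, true_and]
        · rw [if_neg hxy]
          exact (sum_eq_zero fun z _ => if_neg fun hc => hxy ⟨hc.1, hc.2.1⟩).symm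
      rw [e4]
      simp only [FiveSixSphere.tris, FiveSixSphere.linkArcs, ← sum_add_distrib]
      refine sum_congr rfl fun x _ => sum_congr rfl fun y _ => sum_congr rfl fun z _ => ?_
      by_cases ha : S.Tri x y z
      · have := hD.mem_cells_iff ha.2.2.2
        simp only [mem_insert, mem_singleton, exists_eq_or_imp, exists_eq_left, ← hT] at this
        simp only [this, FiveSixSphere.triInd_of_tri ha, ne_eq, ha.1, ha.2.1, ha.2.2.1, mem_compl]
        split_ifs <;> first | rfl | tauto
      · rw [FiveSixSphere.triInd_of_not_tri ha,
          if_neg fun hc => ha ⟨hc.1, hc.2.1, hc.2.2.1, D.mem_of_mem _ hc.2.2.2⟩]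
        simp
    have h2 := FiveSixSphere.sixChi_univ (S := S)
    have h3 := FiveSixSphere.sixChi_add_compl (S := S) T
    have h4 : (#T : ℤ) + #Tᶜ = #(univ : Finset V) := by
      exact_mod_cast card_add_card_compl T
    rw [e1] at h1
    simp only [FiveSixSphere.sixChi] at h2 h3 ⊢
    linarith

/-- A boundary `1`-cell is dual to an edge with exactly one end in the set `T` of `2`-cells. -/
lemma perim_eq_boundaryLength {D : DualSubcomplex K} {T : Finset V}
    (hT : ∀ v, v ∈ T ↔ v ∈ D.twoCells) : h.toFiveSixSphere.perim T = D.boundaryLength := by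
  classical
  set S := h.toFiveSixSphere
  have h1 := two_mul_ncard_edges {e ∈ D.cells | {v | v ∈ e ∧ v ∈ D.twoCells}.ncard = 1}
  have h2 : {σ ∈ {e ∈ D.cells | {v | v ∈ e ∧ v ∈ D.twoCells}.ncard = 1} | σ.card = 2} =
      D.boundaryEdges := by
    ext e
    simp only [DualSubcomplex.boundaryEdges, Set.mem_ofPred_eq]
    tauto
  have hn : ∀ x y : V, x ≠ y → ({v | v ∈ ({x, y} : Finset V) ∧ v ∈ D.twoCells}.ncard = 1 ↔
      (x ∈ T ↔ y ∉ T)) := by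
    intro x y hxy
    have : {v | v ∈ ({x, y} : Finset V) ∧ v ∈ D.twoCells} =
        (({x, y} : Finset V).filter (· ∈ T) : Finset V) := by
      ext v; simp [hT]
    rw [this, Set.ncard_coe_finset, filter_insert, filter_singleton]
    by_cases hx : x ∈ T <;> by_cases hy : y ∈ T <;> simp [hx, hy, hxy]
  have h3 : (∑ x : V, ∑ y : V, if x ≠ y ∧ ({x, y} : Finset V) ∈
      {e ∈ D.cells | {v | v ∈ e ∧ v ∈ D.twoCells}.ncard = 1} then (1 : ℤ) else 0) =
      S.arcs T Tᶜ + S.arcs Tᶜ T := by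
    simp only [FiveSixSphere.arcs, FiveSixSphere.nbrs]
    rw [sum_sum_mem T, sum_sum_mem Tᶜ]
    simp only [← sum_add_distrib]
    refine sum_congr rfl fun x _ => sum_congr rfl fun y _ => ?_
    by_cases ha : S.Adj x y
    · have h4 : x ∈ T ∨ y ∈ T → ({x, y} : Finset V) ∈ D.cells := by
        rintro (hx | hy)
        · exact D.closed {x} ((hT x).1 hx) _ ha.2 (by simp)
        · exact D.closed {y} ((hT y).1 hy) _ ha.2 (by simp)
      simp only [Set.mem_ofPred_eq, hn x y ha.1, FiveSixSphere.adjInd_of_adj ha, ne_eq, ha.1,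
        mem_compl]
      by_cases hx : x ∈ T <;> by_cases hy : y ∈ T <;> simp [hx, hy] <;> simp_all
    · rw [FiveSixSphere.adjInd_of_not_adj ha, if_neg fun hc => ha ⟨hc.1, D.mem_of_mem _ hc.2.1⟩]
      simp
  rw [h2] at h1
  have h5 : 2 * (D.boundaryEdges.ncard : ℤ) = S.arcs T Tᶜ + S.arcs Tᶜ T := by
    rw [← h3]; convert h1
  rw [FiveSixSphere.arcs_comm Tᶜ] at h5
  have h4 : S.perim T = S.arcs T Tᶜ := rfl
  rw [DualSubcomplex.boundaryLength]
  linarith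

lemma pent_eq_ncard_pentagons {D : DualSubcomplex K} {T : Finset V}
    (hT : ∀ v, v ∈ T ↔ v ∈ D.twoCells) : h.toFiveSixSphere.pent T = D.pentagons.ncard := by
  classical
  have h1 : D.pentagons = ({v ∈ T | degree K v = 5} : Finset V) := by
    ext v; simp [DualSubcomplex.pentagons, hT]
  rw [h1, Set.ncard_coe_finset, card_filter, FiveSixSphere.pent]
  push_cast
  refine sum_congr rfl fun x _ => ?_
  rw [FiveSixSphere.defect, nbrs_univ_eq_degree]
  rcases h.degree_eq x with hx | hx <;> simp [hx]

end Complex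
end Soccer

theorem mainTheorem3 {V : Type*} [DecidableEq V] (K : AbstractSimplicialComplex V)
    (D : Soccer.DualSubcomplex K) (hD : Soccer.IsSoccerDiagram D)
    (hcells : 6 ≤ D.twoCells.ncard) (hpent : D.pentagons.ncard ≤ 6) :
    15 ≤ D.boundaryLength := by
  classical
  have := hD.sphere.finite_vertices
  have := Fintype.ofFinite V
  have hT : ∀ v, v ∈ D.twoCells.toFinset ↔ v ∈ D.twoCells := fun v => Set.mem_toFinset
  have hp := Soccer.pent_eq_ncard_pentagons hD.sphere hT
  have hb := Soccer.perim_eq_boundaryLength hD.sphere hT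
  have h := ((Soccer.disc_of_isDisc hD.sphere hD.disc hT).bounds (by omega)).1 (by
    rwa [← Set.ncard_eq_toFinset_card'])
  omega
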